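/- **Setting.** Let $K_1,K_2\ge 2$ and $N\ge 1$ be integers and $0\le M_1,M_2\le N$ reals. A server holds $N$ files of $F$ bits; it is connected to $K_1$ helpers, each with a memory of $M_1F$ bits, and helper $i$ is connected to $K_2$ users $(i,1),\dots,(i,K_2)$, each with a memory of $M_2F$ bits. User $(i,j)$ requests file $d_{i,j}$. The memories are filled before the demand $d=(d_{i,j})$ is known; then the server sends a message $Y_S$ to all helpers, helper $i$ sends a message $Y_{H_i}$ to its users (computed from $Y_S$, its memory and the requests of its users), and each user must recover its file from $Y_{H_i}$ and its memory. The tuple $(M_1,M_2,R_1,R_2)$ is achievable if for every $\varepsilon>0$ and all large $F$ there is such a protocol with $|Y_S|\le R_1F$, $|Y_{H_i}|\le R_2F$ and error probability at most $\varepsilon$ for every demand; the feasible rate region is the closure of the set of $(R_1,R_2)$ for which $(M_1,M_2,R_1,R_2)$ is achievable. **Hybrid scheme.** Let $\alpha,\beta\in[0,1]$. Split each file into a first part of $\lfloor\alpha F\rfloor$ bits and a second part with the remaining bits. Independently and uniformly at random, each helper picks $\lfloor M_1F/N\rfloor$ bits of the first part of each file, and each user picks $\lfloor\beta M_2F/N\rfloor$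 bits of the first part and $\lfloor(1-\beta)M_2F/N\rfloor$ bits of the second part of each file (all bits of the part, if it has fewer). Subfiles of different lengths are zero-padded before being added. * *First parts (S&C scheme).* For each $j$ and each nonempty set $S$ of helpers, the server sends the XOR over $i\in S$ of the subfiles consisting of the bits of $f_{d_{i,j}}$ that are cached at exactly the helpers $S\setminus\{i\}$ and are not cached at user $(i,j)$. For each nonempty $T\subseteq\{1,\dots,K_2\}$, helper $i$ sends the XOR over $j\in T$ of the subfiles of the bits of $f_{d_{i,j}}$ cached, among the users of helper $i$, at exactly $\{(i,j'):j'\in T\setminus\{j\}\}$. * *Second parts (scheme B).* For each nonempty set $S$ of users, the server sends the XOR over $u\in S$ of the subfiles of the bits of $f_{d_u}$ cached at exactly the users $S\setminus\{u\}$; helper $i$ forwards those XORs for which $S$ contains one of its users. The *generalized scheme* of prior work is the same, except that in the first subsystem the server does not omit the bits cached at user $(i,j)$ (scheme A). **Rates.** For $0\le p\le1$ let $r(p,K)=\frac{1-p}{p}\bigl(1-(1-p)^K\bigr)$ if $p>0$ and $r(0,K)=K$. Put $$p=\min\Bigl\{1,\tfrac{M_1}{\alpha N}\Bigr\},\qquad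 q=\min\Bigl\{1,\tfrac{\beta M_2}{\alpha N}\Bigr\},\qquad s=\min\Bigl\{1,\tfrac{(1-\beta)M_2}{(1-\alpha)N}\Bigr\},$$ $$R_1^H(\alpha,\beta)=\alpha K_2(1-q)\,r(p,K_1)+(1-\alpha)\,r(s,K_1K_2),\qquad R_2^H(\alpha,\beta)=\alpha\, r(q,K_2)+(1-\alpha)\,r(s,K_2),$$ $$R_1^G(\alpha,\beta)=\alpha K_2\,r(p,K_1)+(1-\alpha)\,r(s,K_1K_2),\qquad R_2^G(\alpha,\beta)=\alpha\, r(q,K_2)+(1-\alpha)\,r(s,K_2),$$ where a term with factor $\alpha=0$ or $1-\alpha=0$ is $0$. **Lemma (hybrid caching scheme rates).** For all $\alpha,\beta\in[0,1]$: 1. For every $F$, every outcome of the placement fits into the memories, and for every demand the delivery is error-free, both for the hybrid and for the generalized scheme (the placement, hence which bit is cached where, and the demand are known to all nodes here): each helper can compute its message from $Y_S$ and its memory, and each user can compute its file from the message of its helper and its memory. For every placement and demand the server message of the hybrid scheme is at most as long as that of the generalized scheme; the helper messages are the same. 2. With the hybrid scheme, $|Y_S|/F$ and $\max_i|Y_{H_i}|/F$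 converge to $R_1^H(\alpha,\beta)$ and $R_2^H(\alpha,\beta)$ in probability as $F\to\infty$, jointly for all demands. With the generalized scheme they converge in the same sense to $R_1^G(\alpha,\beta)$ and $R_2^G(\alpha,\beta)$. 3. $(R_1^H(\alpha,\beta),R_2^H(\alpha,\beta))$ belongs to the feasible rate region. 4. If $0<\alpha,\beta<1$, $M_1,M_2>0$, $M_1\le\alpha N$, $\beta M_2\le\alpha N$ and $(1-\beta)M_2\le(1-\alpha)N$, then $$R_1^H(\alpha,\beta)=\alpha K_2\Bigl(1-\tfrac{M_1}{\alpha N}\Bigr)\Bigl(1-\tfrac{\beta M_2}{\alpha N}\Bigr)\tfrac{\alpha N}{M_1}\Bigl(1-\bigl(1-\tfrac{M_1}{\alpha N}\bigr)^{K_1}\Bigr)+(1-\alpha)\Bigl(1-\tfrac{(1-\beta)M_2}{(1-\alpha)N}\Bigr)\tfrac{(1-\alpha)N}{(1-\beta)M_2}\Bigl(1-\bigl(1-\tfrac{(1-\beta)M_2}{(1-\alpha)N}\bigr)^{K_1K_2}\Bigr),$$ $$R_2^H(\alpha,\beta)=\alpha\Bigl(1-\tfrac{\beta M_2}{\alpha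 N}\Bigr)\tfrac{\alpha N}{\beta M_2}\Bigl(1-\bigl(1-\tfrac{\beta M_2}{\alpha N}\bigr)^{K_2}\Bigr)+(1-\alpha)\Bigl(1-\tfrac{(1-\beta)M_2}{(1-\alpha)N}\Bigr)\tfrac{(1-\alpha)N}{(1-\beta)M_2}\Bigl(1-\bigl(1-\tfrac{(1-\beta)M_2}{(1-\alpha)N}\bigr)^{K_2}\Bigr).$$ 5. $R_1^H(\alpha,\beta)\le R_1^G(\alpha,\beta)$ and $R_2^H(\alpha,\beta)=R_2^G(\alpha,\beta)$. -/

import Mathlib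

open Finset Filter Topology

noncomputable section

namespace TwoLayer

/-! ### The network: `K₁` helpers, user `(i, j)` is the `j`-th user attached to helper `i`,
`N` files of `F` bits each -/

/-- The users of the network. -/
abbrev User (K₁ K₂ : ℕ) := Fin K₁ × Fin K₂

/-- The library: `w n b` is the `b`-th bit of file `n`. -/
abbrev Files (N F : ℕ) := Fin N → Fin F → ZMod 2

/-- The requests: user `u` asks for file `d u`. -/
abbrev Demand (K₁ K₂ N : ℕ) := User K₁ K₂ → Fin N

/-! ### Codes and the feasible rate region -/

/-- A two-phase caching protocol for files of `F` bits, with `mH` (`mU`) bits of memory per helper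
(user), server messages of `ℓS` bits and helper messages of `ℓH` bits.  The placement does not
depend on the demand; helper `i` only learns the requests of its own users, a user only its own. -/
structure Code (K₁ K₂ N F mH mU ℓS ℓH : ℕ) where
  placeHelper : Fin K₁ → Files N F → (Fin mH → ZMod 2)
  placeUser : User K₁ K₂ → Files N F → (Fin mU → ZMod 2)
  server : Demand K₁ K₂ N → Files N F → (Fin ℓS → ZMod 2)
  helper : Fin K₁ → (Fin K₂ → Fin N) → (Fin ℓS → ZMod 2) → (Fin mH → ZMod 2) → (Fin ℓH → ZMod 2)
  decode : User K₁ K₂ → Fin N → (Fin ℓH → ZMod 2) → (Fin mU → ZMod 2) → (Fin F → ZMod 2)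

/-- What user `u` reconstructs when the demand is `d` and the library is `w`. -/
def Code.output {K₁ K₂ N F mH mU ℓS ℓH : ℕ} (c : Code K₁ K₂ N F mH mU ℓS ℓH)
    (d : Demand K₁ K₂ N) (w : Files N F) (u : User K₁ K₂) : Fin F → ZMod 2 :=
  c.decode u (d u)
    (c.helper u.1 (fun j => d (u.1, j)) (c.server d w) (c.placeHelper u.1 w))
    (c.placeUser u w)

/-- The probability, over uniformly distributed independent files, that some user fails to
reconstruct its requested file. -/
def Code.errorProb {K₁ K₂ N F mH mU ℓS ℓH : ℕ} (c : Code K₁ K₂ N F mH mU ℓS ℓH)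
    (d : Demand K₁ K₂ N) : ℝ :=
  (#{w : Files N F | ∃ u, c.output d w u ≠ w (d u)} : ℝ) / Fintype.card (Files N F)

/-- The tuple `(M₁, M₂, R₁, R₂)` is achievable: for all large file sizes `F` there is a code that
respects the memory sizes `M₁ F`, `M₂ F` and the message lengths `R₁ F`, `R₂ F`, with arbitrarily
small error probability for every demand. -/
def Achievable (K₁ K₂ N : ℕ) (M₁ M₂ R₁ R₂ : ℝ) : Prop :=
  ∀ ε : ℝ, 0 < ε → ∃ F₀ : ℕ, ∀ F : ℕ, F₀ ≤ F →
    ∃ (mH mU ℓS ℓH : ℕ) (c : Code K₁ K₂ N F mH mU ℓS ℓH),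
      (mH : ℝ) ≤ M₁ * F ∧ (mU : ℝ) ≤ M₂ * F ∧ (ℓS : ℝ) ≤ R₁ * F ∧ (ℓH : ℝ) ≤ R₂ * F ∧
      ∀ d : Demand K₁ K₂ N, c.errorProb d ≤ ε

/-- The feasible rate region: the closure of the set of achievable rate pairs. -/
def feasibleRegion (K₁ K₂ N : ℕ) (M₁ M₂ : ℝ) : Set (ℝ × ℝ) :=
  closure {R : ℝ × ℝ | Achievable K₁ K₂ N M₁ M₂ R.1 R.2}

/-! ### Coded multicasting -/

/-- The `t`-th bit of the subfile of `f` formed by the positions in `s` (in increasing order),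
padded with zeros. -/
def segBit {F : ℕ} (f : Fin F → ZMod 2) (s : Finset (Fin F)) (t : ℕ) : ZMod 2 :=
  if h : t < #s then f (s.orderEmbOfFin rfl ⟨t, h⟩) else 0

open Classical in
/-- The positions in `P` that are cached at exactly the nodes in `S` (node `k` caches `A k`). -/
def exclusive {F : ℕ} {ι : Type} (P : Finset (Fin F)) (A : ι → Finset (Fin F))
    (S : Finset ι) : Finset (Fin F) :=
  {b ∈ P | ∀ k, b ∈ A k ↔ k ∈ S}

/-- The length of the XOR of the subfiles `seg S k`, `k ∈ S`: the shorter ones are zero-padded. -/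
def codedLen {F : ℕ} {ι : Type} (seg : Finset ι → ι → Finset (Fin F)) (S : Finset ι) : ℕ :=
  S.sup fun k => #(seg S k)

/-- The XOR over `k ∈ S` of the subfiles of `f k` formed by the positions `seg S k`. -/
def codedBlock {F : ℕ} {ι : Type} (f : ι → Fin F → ZMod 2)
    (seg : Finset ι → ι → Finset (Fin F)) (S : Finset ι) : Fin (codedLen seg S) → ZMod 2 :=
  fun t => ∑ k ∈ S, segBit (f k) (seg S k) t

/-! ### Decentralized placement in the split system -/

/-- The positions of the first part of each file. -/
def firstPart (α : ℝ) (F : ℕ) : Finset (Fin F) := {b | (b : ℕ) < ⌊α * F⌋₊}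

/-- The positions of the second part of each file. -/
def secondPart (α : ℝ) (F : ℕ) : Finset (Fin F) := (firstPart α F)ᶜ

/-- A placement: the positions of file `n` that helper `i` caches, those in the first part that
user `u` caches, and those in the second part that user `u` caches. -/
abbrev Placement (K₁ K₂ N F : ℕ) :=
  (Fin K₁ → Fin N → Finset (Fin F)) ×
    (User K₁ K₂ → Fin N → Finset (Fin F)) × (User K₁ K₂ → Fin N → Finset (Fin F))

/-- The ways in which one node can pick `m` positions (all of them, if there are fewer) of `P`. -/
def picks {F : ℕ} (P : Finset (Fin F)) (m : ℕ) : Finset (Finset (Fin F)) :=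
  P.powersetCard (min m #P)

/-- The sample space of the random placement.  Every node picks, for every file, a set of positions
of prescribed size; since this is a product set, the uniform distribution on it makes all these
picks uniform and independent. -/
def placements (K₁ K₂ N : ℕ) (M₁ M₂ α β : ℝ) (F : ℕ) : Finset (Placement K₁ K₂ N F) :=
  (Fintype.piFinset fun _ => Fintype.piFinset fun _ => picks (firstPart α F) ⌊M₁ * F / N⌋₊) ×ˢ
  (Fintype.piFinset fun _ => Fintype.piFinset fun _ =>
    picks (firstPart α F) ⌊β * M₂ * F / N⌋₊) ×ˢ
  (Fintype.piFinset fun _ => Fintype.piFinset fun _ =>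
    picks (secondPart α F) ⌊(1 - β) * M₂ * F / N⌋₊)

section Schemes

variable {K₁ K₂ N F : ℕ}

/-- The content of the memory of helper `i`. -/
def helperCache (π : Placement K₁ K₂ N F) (i : Fin K₁) (w : Files N F) :
    (n : Fin N) → {b // b ∈ π.1 i n} → ZMod 2 :=
  fun n b => w n b

/-- The content of the memory of user `u`. -/
def userCache (π : Placement K₁ K₂ N F) (u : User K₁ K₂) (w : Files N F) :
    (n : Fin N) → {b // b ∈ π.2.1 u n ∪ π.2.2 u n} → ZMod 2 :=
  fun n b => w n b

/-! ### Delivery -/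

/-- A rule for the subfiles that the server combines in the first subsystem: for the `j`-th users,
a set `S` of helpers and `i ∈ S`, the positions of the file of user `(i, j)` that are used. -/
abbrev SegmentRule (K₁ K₂ N F : ℕ) :=
  Placement K₁ K₂ N F → Demand K₁ K₂ N → Fin K₂ → Finset (Fin K₁) → Fin K₁ → Finset (Fin F)

/-- Scheme A: the bits of the first part that are cached exclusively at the helpers `S \ {i}`. -/
def segA (α : ℝ) : SegmentRule K₁ K₂ N F := fun π d j S i =>
  exclusive (firstPart α F) (fun i' => π.1 i' (d (i, j))) (S.erase i)

/-- S&C scheme: those of the bits of scheme A that are not cached at user `(i, j)`. -/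
def segSC (α : ℝ) : SegmentRule K₁ K₂ N F := fun π d j S i =>
  segA α π d j S i \ π.2.1 (i, j) (d (i, j))

/-- First subsystem, helper `i` to its users: for a set `T` of users of helper `i` and `j ∈ T`, the
bits of the file of user `(i, j)` cached exclusively (among the users of `i`) at `T \ {j}`. -/
def segUser (α : ℝ) (π : Placement K₁ K₂ N F) (d : Demand K₁ K₂ N) (i : Fin K₁)
    (T : Finset (Fin K₂)) (j : Fin K₂) : Finset (Fin F) :=
  exclusive (firstPart α F) (fun j' => π.2.1 (i, j') (d (i, j))) (T.erase j)

/-- Second subsystem (scheme B), server to all users: for a set `S` of users and `u ∈ S`, the bits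
of the second part of the file of user `u` cached exclusively at the users `S \ {u}`. -/
def segB (α : ℝ) (π : Placement K₁ K₂ N F) (d : Demand K₁ K₂ N)
    (S : Finset (User K₁ K₂)) (u : User K₁ K₂) : Finset (Fin F) :=
  exclusive (secondPart α F) (fun u' => π.2.2 u' (d u)) (S.erase u)

/-- The message of the server: the coded blocks of both subsystems. -/
def serverMsg (seg : SegmentRule K₁ K₂ N F) (α : ℝ) (π : Placement K₁ K₂ N F)
    (d : Demand K₁ K₂ N) (w : Files N F) :
    ((j : Fin K₂) → (S : Finset (Fin K₁)) → Fin (codedLen (seg π d j) S) → ZMod 2) ×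
      ((S : Finset (User K₁ K₂)) → Fin (codedLen (segB α π d) S) → ZMod 2) :=
  (fun j S => codedBlock (fun i => w (d (i, j))) (seg π d j) S,
    fun S => codedBlock (fun u => w (d u)) (segB α π d) S)

/-- The number of bits of the message of the server. -/
def serverLen (seg : SegmentRule K₁ K₂ N F) (α : ℝ) (π : Placement K₁ K₂ N F)
    (d : Demand K₁ K₂ N) : ℕ :=
  (∑ j, ∑ S, codedLen (seg π d j) S) + ∑ S, codedLen (segB α π d) S

/-- The message of helper `i`: the coded blocks for its own users in the first subsystem, and, in
the second one, those blocks of the server that involve a file requested by one of its users. -/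
def helperMsg (α : ℝ) (π : Placement K₁ K₂ N F) (d : Demand K₁ K₂ N) (i : Fin K₁)
    (w : Files N F) :
    ((T : Finset (Fin K₂)) → Fin (codedLen (segUser α π d i) T) → ZMod 2) ×
      ((S : {S : Finset (User K₁ K₂) // ∃ j, (i, j) ∈ S}) →
        Fin (codedLen (segB α π d) S) → ZMod 2) :=
  (fun T => codedBlock (fun j => w (d (i, j))) (segUser α π d i) T,
    fun S => codedBlock (fun u => w (d u)) (segB α π d) S)

/-- The number of bits of the message of helper `i`. -/
def helperLen (α : ℝ) (π : Placement K₁ K₂ N F) (d : Demand K₁ K₂ N) (i : Fin K₁) : ℕ :=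
  (∑ T, codedLen (segUser α π d i) T) +
    ∑ S : Finset (User K₁ K₂) with ∃ j, (i, j) ∈ S, codedLen (segB α π d) S

/-- Delivery works without error: the message of helper `i` is determined by the message of the
server and the memory of the helper, and the file requested by a user is determined by the message
of its helper and the memory of the user. -/
def DeliveryWorks (seg : SegmentRule K₁ K₂ N F) (α : ℝ) (π : Placement K₁ K₂ N F)
    (d : Demand K₁ K₂ N) : Prop :=
  (∀ (i : Fin K₁) (w w' : Files N F),
      serverMsg seg α π d w = serverMsg seg α π d w' → helperCache π i w = helperCache π i w' →
        helperMsg α π d i w = helperMsg α π d i w') ∧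
  (∀ (u : User K₁ K₂) (w w' : Files N F),
      helperMsg α π d u.1 w = helperMsg α π d u.1 w' → userCache π u w = userCache π u w' →
        w (d u) = w' (d u))

/-- The placement respects the memory sizes `M₁ F` of the helpers and `M₂ F` of the users. -/
def FitsMemory (M₁ M₂ : ℝ) (π : Placement K₁ K₂ N F) : Prop :=
  (∀ i, ((∑ n, #(π.1 i n) : ℕ) : ℝ) ≤ M₁ * F) ∧
  (∀ u, ((∑ n, #(π.2.1 u n ∪ π.2.2 u n) : ℕ) : ℝ) ≤ M₂ * F)

/-- For the placement `π` and every demand, the normalized length of the message of the server and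
the maximal normalized length of the messages of the helpers are within `ε` of `R₁` and `R₂`. -/
def RatesWithin (seg : SegmentRule K₁ K₂ N F) (α R₁ R₂ ε : ℝ) (π : Placement K₁ K₂ N F) : Prop :=
  ∀ d : Demand K₁ K₂ N,
    |(serverLen seg α π d : ℝ) / F - R₁| ≤ ε ∧
    |((univ.sup (helperLen α π d) : ℕ) : ℝ) / F - R₂| ≤ ε

end Schemes

open Classical in
/-- The scheme with memory-sharing parameters `α, β` that uses the rule `seg` in the first subsystem
(and scheme B in the second one) has the rates `R₁`, `R₂`: as `F → ∞`, its normalized message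
lengths converge to `R₁`, `R₂` in probability with respect to the random placement. -/
def HasRates (K₁ K₂ N : ℕ) (M₁ M₂ α β : ℝ) (seg : (F : ℕ) → SegmentRule K₁ K₂ N F)
    (R₁ R₂ : ℝ) : Prop :=
  ∀ ε : ℝ, 0 < ε → Tendsto (fun F : ℕ =>
      (#{π ∈ placements K₁ K₂ N M₁ M₂ α β F | RatesWithin (seg F) α R₁ R₂ ε π} : ℝ) /
        #(placements K₁ K₂ N M₁ M₂ α β F)) atTop (𝓝 1)

/-! ### Rate formulas -/

/-- The fraction of each file that is cached with memory `M` and `N` files. -/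
def frac (M : ℝ) (N : ℕ) : ℝ := min 1 (M / N)

/-- `(1 - p) / p * (1 - (1 - p) ^ K)`, extended continuously to `p = 0`. -/
def mauRate (p : ℝ) (K : ℕ) : ℝ := if p = 0 then K else (1 - p) / p * (1 - (1 - p) ^ K)

/-- Server rate of scheme A. -/
def rateA₁ (K₁ K₂ N : ℕ) (M₁ : ℝ) : ℝ := K₂ * mauRate (frac M₁ N) K₁

/-- Helper rate of scheme A. -/
def rateA₂ (K₂ N : ℕ) (M₂ : ℝ) : ℝ := mauRate (frac M₂ N) K₂

/-- Server rate of the S&C scheme. -/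
def rateSC₁ (K₁ K₂ N : ℕ) (M₁ M₂ : ℝ) : ℝ := K₂ * (1 - frac M₂ N) * mauRate (frac M₁ N) K₁

/-- Helper rate of the S&C scheme. -/
def rateSC₂ (K₂ N : ℕ) (M₂ : ℝ) : ℝ := mauRate (frac M₂ N) K₂

/-- Server rate of scheme B. -/
def rateB₁ (K₁ K₂ N : ℕ) (M₂ : ℝ) : ℝ := mauRate (frac M₂ N) (K₁ * K₂)

/-- Helper rate of scheme B. -/
def rateB₂ (K₂ N : ℕ) (M₂ : ℝ) : ℝ := mauRate (frac M₂ N) K₂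

/-- Server rate of the hybrid scheme: the sum of the rates of the two subsystems, whose files have
`α F` and `(1 - α) F` bits. -/
def rateH₁ (K₁ K₂ N : ℕ) (M₁ M₂ α β : ℝ) : ℝ :=
  α * rateSC₁ K₁ K₂ N (M₁ / α) (β * M₂ / α) +
    (1 - α) * rateB₁ K₁ K₂ N ((1 - β) * M₂ / (1 - α))

/-- Helper rate of the hybrid scheme. -/
def rateH₂ (K₂ N : ℕ) (M₂ α β : ℝ) : ℝ :=
  α * rateSC₂ K₂ N (β * M₂ / α) + (1 - α) * rateB₂ K₂ N ((1 - β) * M₂ / (1 - α))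

/-- Server rate of the generalized scheme (scheme A in the first subsystem). -/
def rateG₁ (K₁ K₂ N : ℕ) (M₁ M₂ α β : ℝ) : ℝ :=
  α * rateA₁ K₁ K₂ N (M₁ / α) + (1 - α) * rateB₁ K₁ K₂ N ((1 - β) * M₂ / (1 - α))

/-- Helper rate of the generalized scheme. -/
def rateG₂ (K₂ N : ℕ) (M₂ α β : ℝ) : ℝ :=
  α * rateA₂ K₂ N (β * M₂ / α) + (1 - α) * rateB₂ K₂ N ((1 - β) * M₂ / (1 - α))

end TwoLayer

end

/-!
The lemma has a combinatorial and a probabilistic half.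

*Delivery.* For a node `k` and a position `b` that it does not cache, let `S` consist of `k` and of
the nodes that cache `b`. Then `b` lies in the subfile of `k` inside the block of `S`, and the other
subfiles of this block are cached at `k`; so `k` decodes `b`
(`eq_of_codedBlock_exclusive_eq`). A helper needs only those bits of the file of user `(i, j)` that
this user lacks, hence the S&C scheme may omit the others: any rule between the S&C scheme and
scheme A works (`deliveryWorks_of_subset`).

*Rates.* The length of each subfile is the number of positions with a prescribed pattern of
membership in finitely many independent uniform sets of prescribed size. For one such set, the
memberships of two positions are negatively correlated, and this survives intersection over
independent sets. So the count has variance at most the size of the part, hence at most `F`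
(`sum_sq_card_pattern_sub_le`), and Chebyshev's inequality makes its normalization converge in
probability to the product of the cached or uncached fractions (`tendstoInProb_card_pattern`). All
subfiles of a block have the same limit, so zero-padding costs nothing asymptotically, and summing
over the blocks with the binomial theorem gives the rate function (`sum_powerset_blockRate`). For a
helper in the second subsystem, the blocks of the sets that avoid its users are subtracted from the
total, which leaves the rate of a system with `K₂` users (`sum_blockRate_meeting`).

*Feasibility.* For large `F` some placement has rates within a small tolerance of the limits for
all demands. It is used deterministically; since a node of a code knows only its own requests, the
server and the helpers prepend the demand, whose length does not depend on `F`
(`mem_feasibleRegion_of_hasRates`).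
-/

noncomputable section

namespace TwoLayer

/-! ### Decoding coded blocks -/

section Decoding

variable {F : ℕ} {ι : Type}

lemma segBit_congr {f f' : Fin F → ZMod 2} {s : Finset (Fin F)} (h : ∀ b ∈ s, f b = f' b) (t : ℕ) :
    segBit f s t = segBit f' s t := by
  unfold segBit
  split_ifs with ht
  · exact h _ (s.orderEmbOfFin_mem rfl _)
  · rfl

lemma exists_segBit_eq {s : Finset (Fin F)} {b : Fin F} (hb : b ∈ s) :
    ∃ t < #s, ∀ f : Fin F → ZMod 2, segBit f s t = f b := by
  have : b ∈ Set.range (s.orderEmbOfFin rfl) := by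
    rw [Finset.range_orderEmbOfFin]; exact hb
  obtain ⟨t, rfl⟩ := this
  exact ⟨t, t.2, fun f => by simp [segBit]⟩

lemma codedBlock_congr {f f' : ι → Fin F → ZMod 2} {seg : Finset ι → ι → Finset (Fin F)}
    {S : Finset ι} (h : ∀ k ∈ S, ∀ b ∈ seg S k, f k b = f' k b) :
    codedBlock f seg S = codedBlock f' seg S := by
  funext t
  exact Finset.sum_congr rfl fun k hk => segBit_congr (h k hk) t

lemma mem_exclusive {P : Finset (Fin F)} {A : ι → Finset (Fin F)} {S : Finset ι} {b : Fin F} :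
    b ∈ exclusive P A S ↔ b ∈ P ∧ ∀ k, b ∈ A k ↔ k ∈ S := by
  simp [exclusive]

/-- A receiver that knows all but one of the subfiles of a coded block recovers the last one. -/
lemma eq_of_codedBlock_eq {f f' : ι → Fin F → ZMod 2} {seg : Finset ι → ι → Finset (Fin F)}
    {S : Finset ι} (h : codedBlock f seg S = codedBlock f' seg S) {k : ι} (hk : k ∈ S)
    (hother : ∀ l ∈ S, l ≠ k → ∀ b ∈ seg S l, f l b = f' l b) {b : Fin F} (hb : b ∈ seg S k) :
    f k b = f' k b := by
  classical
  obtain ⟨t, ht, hval⟩ := exists_segBit_eq hb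
  have hlen : t < codedLen seg S :=
    ht.trans_le (Finset.le_sup (f := fun k => #(seg S k)) hk)
  have h1 := congrFun h ⟨t, hlen⟩
  simp only [codedBlock] at h1
  rw [← Finset.add_sum_erase _ _ hk, ← Finset.add_sum_erase _ _ hk] at h1
  have h2 : ∑ l ∈ S.erase k, segBit (f l) (seg S l) t =
      ∑ l ∈ S.erase k, segBit (f' l) (seg S l) t :=
    Finset.sum_congr rfl fun l hl =>
      segBit_congr (hother l (Finset.mem_of_mem_erase hl) (Finset.ne_of_mem_erase hl)) t
  rw [h2] at h1
  simpa [hval] using add_right_cancel h1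

/-- Decoding with exclusive subfiles: if node `k` knows the bits in `A k` of all files, it recovers
from the coded blocks those bits of its own file that it does not cache. The subfiles may be
thinned out, as long as the wanted bit is kept. -/
lemma eq_of_codedBlock_exclusive_eq [Fintype ι] [DecidableEq ι] {P : Finset (Fin F)}
    {A : ι → ι → Finset (Fin F)} {f f' : ι → Fin F → ZMod 2}
    {seg : Finset ι → ι → Finset (Fin F)}
    (hseg : ∀ S l, seg S l ⊆ exclusive P (A l) (S.erase l)) {k : ι} {b : Fin F}
    (hkeep : ∀ S, b ∈ exclusive P (A k) (S.erase k) → b ∈ seg S k)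
    (h : ∀ S, k ∈ S → codedBlock f seg S = codedBlock f' seg S)
    (hcache : ∀ l, ∀ b ∈ A l k, f l b = f' l b) (hb : b ∈ P) : f k b = f' k b := by
  classical
  by_cases hbk : b ∈ A k k
  · exact hcache k b hbk
  set S : Finset ι := insert k (univ.filter fun l => b ∈ A k l) with hS
  have hk : k ∈ S := Finset.mem_insert_self _ _
  refine eq_of_codedBlock_eq (h S hk) hk (fun l hl hlk b' hb' => ?_) (hkeep S ?_)
  · have := (mem_exclusive.1 (hseg S l hb')).2 k
    exact hcache l b' (this.2 (Finset.mem_erase.2 ⟨hlk.symm, hk⟩))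
  · refine mem_exclusive.2 ⟨hb, fun l => ?_⟩
    by_cases hlk : l = k
    · subst hlk; simp [hbk]
    · simp [hS, hlk]

end Decoding

/-! ### Error-free delivery -/

section Delivery

variable {K₁ K₂ N F : ℕ}

/-- Delivery is error-free for every rule between the S&C scheme and scheme A. -/
lemma deliveryWorks_of_subset (seg : SegmentRule K₁ K₂ N F) (α : ℝ) (π : Placement K₁ K₂ N F)
    (d : Demand K₁ K₂ N) (hA : ∀ j S i, seg π d j S i ⊆ segA α π d j S i)
    (hSC : ∀ j S i, segSC α π d j S i ⊆ seg π d j S i) : DeliveryWorks seg α π d := by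
  refine ⟨fun i w w' hmsg hc => ?_, fun u w w' hmsg hc => ?_⟩
  · have hc' : ∀ n, ∀ b ∈ π.1 i n, w n b = w' n b := fun n b hb =>
      congrFun (congrFun hc n) ⟨b, hb⟩
    refine Prod.ext (funext fun T => codedBlock_congr fun j hj b hb => ?_)
      (funext fun S => congrFun (congrArg Prod.snd hmsg) S.1)
    obtain ⟨hbP, hbT⟩ := mem_exclusive.1 hb
    -- A bit that user `(i, j)` lacks is one that the S&C scheme does not omit.
    have hbu : b ∉ π.2.1 (i, j) (d (i, j)) := fun h => by simpa using (hbT j).1 h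
    exact eq_of_codedBlock_exclusive_eq (P := firstPart α F)
      (A := fun l i' => π.1 i' (d (l, j))) (f := fun i => w (d (i, j)))
      (f' := fun i => w' (d (i, j))) (seg := seg π d j) (fun S l => hA j S l)
      (fun S hS => hSC j S i (Finset.mem_sdiff.2 ⟨hS, hbu⟩))
      (fun S _ => congrFun (congrFun (congrArg Prod.fst hmsg) j) S)
      (fun l b hb => hc' _ b hb) hbP
  · obtain ⟨i, j⟩ := u
    have hc' : ∀ n, ∀ b ∈ π.2.1 (i, j) n ∪ π.2.2 (i, j) n, w n b = w' n b := fun n b hb =>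
      congrFun (congrFun hc n) ⟨b, hb⟩
    funext b
    by_cases hb : b ∈ firstPart α F
    · exact eq_of_codedBlock_exclusive_eq (P := firstPart α F) (k := j)
        (A := fun l j' => π.2.1 (i, j') (d (i, l))) (f := fun j => w (d (i, j)))
        (f' := fun j => w' (d (i, j))) (seg := segUser α π d i) (fun S l => subset_rfl)
        (fun S hS => hS) (fun S _ => congrFun (congrArg Prod.fst hmsg) S)
        (fun l b hb => hc' _ b (Finset.mem_union_left _ hb)) hb
    · exact eq_of_codedBlock_exclusive_eq (P := secondPart α F) (k := (i, j))
        (A := fun l u' => π.2.2 u' (d l)) (f := fun u => w (d u))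
        (f' := fun u => w' (d u)) (seg := segB α π d) (fun S l => subset_rfl)
        (fun S hS => hS) (fun S hS => congrFun (congrArg Prod.snd hmsg) ⟨S, j, hS⟩)
        (fun l b hb => hc' _ b (Finset.mem_union_right _ hb)) (Finset.mem_compl.2 hb)

lemma deliveryWorks_segSC (α : ℝ) (π : Placement K₁ K₂ N F) (d : Demand K₁ K₂ N) :
    DeliveryWorks (segSC α) α π d :=
  deliveryWorks_of_subset _ α π d (fun _ _ _ => Finset.sdiff_subset) fun _ _ _ => subset_rfl

lemma deliveryWorks_segA (α : ℝ) (π : Placement K₁ K₂ N F) (d : Demand K₁ K₂ N) :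
    DeliveryWorks (segA α) α π d :=
  deliveryWorks_of_subset _ α π d (fun _ _ _ => subset_rfl) fun _ _ _ => Finset.sdiff_subset

lemma serverLen_segSC_le (α : ℝ) (π : Placement K₁ K₂ N F) (d : Demand K₁ K₂ N) :
    serverLen (segSC α) α π d ≤ serverLen (segA α) α π d := by
  refine Nat.add_le_add_right (Finset.sum_le_sum fun j _ => Finset.sum_le_sum fun S _ => ?_) _
  exact Finset.sup_mono_fun fun i _ => Finset.card_le_card Finset.sdiff_subset

/-! ### Memory sizes -/

lemma card_le_of_mem_picks {P A : Finset (Fin F)} {m : ℕ} (h : A ∈ picks P m) : #A ≤ m :=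
  (Finset.mem_powersetCard.1 h).2.le.trans (min_le_left _ _)

lemma picks_nonempty (P : Finset (Fin F)) (m : ℕ) : (picks P m).Nonempty :=
  Finset.powersetCard_nonempty.2 (min_le_right _ _)

lemma placements_nonempty (M₁ M₂ α β : ℝ) : (placements K₁ K₂ N M₁ M₂ α β F).Nonempty := by
  refine Finset.Nonempty.product ?_ (Finset.Nonempty.product ?_ ?_) <;>
  exact Fintype.piFinset_nonempty.2 fun _ => Fintype.piFinset_nonempty.2 fun _ =>
    picks_nonempty _ _

lemma fitsMemory_of_mem_placements {M₁ M₂ α β : ℝ} (hN : 1 ≤ N) (hM₁ : 0 ≤ M₁) (hM₂ : 0 ≤ M₂)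
    (hβ : β ∈ Set.Icc (0 : ℝ) 1) {π : Placement K₁ K₂ N F}
    (hπ : π ∈ placements K₁ K₂ N M₁ M₂ α β F) : FitsMemory M₁ M₂ π := by
  have hN' : (0 : ℝ) < N := by exact_mod_cast hN
  simp only [placements, Finset.mem_product, Fintype.mem_piFinset] at hπ
  obtain ⟨h1, h2, h3⟩ := hπ
  have key : ∀ (M : ℝ) (c : Fin N → ℕ), (∀ n, (c n : ℝ) ≤ M * F / N) →
      ((∑ n, c n : ℕ) : ℝ) ≤ M * F := fun M c hc => by
    push_cast
    calc ∑ n, (c n : ℝ) ≤ ∑ _n : Fin N, M * F / N := Finset.sum_le_sum fun n _ => hc n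
      _ = M * F := by simp; field_simp
  refine ⟨fun i => key _ _ fun n => ?_, fun u => key _ _ fun n => ?_⟩
  · exact (Nat.cast_le.2 (card_le_of_mem_picks (h1 i n))).trans (Nat.floor_le (by positivity))
  · have hb0 := hβ.1
    have hb1 : 0 ≤ 1 - β := sub_nonneg.2 hβ.2
    have e2 := (Nat.cast_le (α := ℝ).2 (card_le_of_mem_picks (h2 u n))).trans
      (Nat.floor_le (by positivity))
    have e3 := (Nat.cast_le (α := ℝ).2 (card_le_of_mem_picks (h3 u n))).trans
      (Nat.floor_le (by positivity))
    have e4 : ((#(π.2.1 u n ∪ π.2.2 u n) : ℕ) : ℝ) ≤ #(π.2.1 u n) + #(π.2.2 u n) := by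
      exact_mod_cast Finset.card_union_le _ _
    have e5 : β * M₂ * F / N + (1 - β) * M₂ * F / N = M₂ * F / N := by ring
    linarith

/-! ### From placements to codes -/

lemma exists_embedding_bits {X : Type} [Finite X] {m : ℕ} (h : Nat.card X ≤ 2 ^ m) :
    Nonempty (X ↪ (Fin m → ZMod 2)) := by
  classical
  have := Fintype.ofFinite X
  refine Function.Embedding.nonempty_of_card_le ?_
  simpa [ZMod.card] using h

/-- Tuples of blocks, each with its own number of bits, preceded by the demand, fit into a bit
string that is longer by a number of bits that depends only on the number of demands. -/
lemma exists_embedding_sigma {D : Type} [Fintype D] {X : D → Type} [∀ d, Finite (X d)] {L : ℕ}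
    (h : ∀ d, Nat.card (X d) ≤ 2 ^ L) :
    Nonempty ((Σ d, X d) ↪ (Fin (Fintype.card D + L) → ZMod 2)) := by
  refine exists_embedding_bits ?_
  rw [Nat.card_sigma, pow_add]
  calc ∑ d, Nat.card (X d) ≤ ∑ _d : D, 2 ^ L := Finset.sum_le_sum fun d _ => h d
    _ = Fintype.card D * 2 ^ L := by simp
    _ ≤ _ := Nat.mul_le_mul_right _ Nat.lt_two_pow_self.le

/-- A placement gives a code without errors. As the nodes of a code know only their own requests,
the messages carry the whole demand, at the cost of a number of bits that does not depend on the
file size. -/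
lemma exists_code (seg : SegmentRule K₁ K₂ N F) (α : ℝ) (π : Placement K₁ K₂ N F)
    (hdel : ∀ d, DeliveryWorks seg α π d) {mH mU LS LH : ℕ}
    (hH : ∀ i, ∑ n, #(π.1 i n) ≤ mH) (hU : ∀ u, ∑ n, #(π.2.1 u n ∪ π.2.2 u n) ≤ mU)
    (hLS : ∀ d, serverLen seg α π d ≤ LS) (hLH : ∀ d i, helperLen α π d i ≤ LH) :
    ∃ c : Code K₁ K₂ N F mH mU (Fintype.card (Demand K₁ K₂ N) + LS)
      (Fintype.card (Demand K₁ K₂ N) + LH), ∀ d w u, c.output d w u = w (d u) := by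
  classical
  have eH : ∀ i, Nonempty (((n : Fin N) → {b // b ∈ π.1 i n} → ZMod 2) ↪ (Fin mH → ZMod 2)) :=
    fun i => exists_embedding_bits (by
      simpa [Nat.card_eq_fintype_card, ZMod.card, Finset.prod_pow_eq_pow_sum] using
        Nat.pow_le_pow_right two_pos (hH i))
  have eU : ∀ u, Nonempty (((n : Fin N) → {b // b ∈ π.2.1 u n ∪ π.2.2 u n} → ZMod 2) ↪
      (Fin mU → ZMod 2)) :=
    fun u => exists_embedding_bits (by
      have := Nat.pow_le_pow_right two_pos (hU u)
      rw [← Finset.prod_pow_eq_pow_sum] at this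
      simpa only [Nat.card_eq_fintype_card, ZMod.card, Fintype.card_pi, Fintype.card_coe,
        Finset.prod_const, Finset.card_univ] using this)
  have eS := exists_embedding_sigma (D := Demand K₁ K₂ N) (L := LS)
    (X := fun d => ((j : Fin K₂) → (S : Finset (Fin K₁)) →
        Fin (codedLen (seg π d j) S) → ZMod 2) ×
      ((S : Finset (User K₁ K₂)) → Fin (codedLen (segB α π d) S) → ZMod 2))
    (fun d => by
      have := Nat.pow_le_pow_right two_pos (hLS d)
      simpa [serverLen, Nat.card_eq_fintype_card, ZMod.card, Finset.prod_pow_eq_pow_sum,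
        pow_add] using this)
  have eM : ∀ i, _ := fun i => exists_embedding_sigma (D := Demand K₁ K₂ N) (L := LH)
    (X := fun d => ((T : Finset (Fin K₂)) → Fin (codedLen (segUser α π d i) T) → ZMod 2) ×
      ((S : {S : Finset (User K₁ K₂) // ∃ j, (i, j) ∈ S}) →
        Fin (codedLen (segB α π d) S) → ZMod 2))
    (fun d => by
      have := Nat.pow_le_pow_right two_pos (hLH d i)
      rw [helperLen, Finset.sum_subtype (p := fun S : Finset (User K₁ K₂) => ∃ j, (i, j) ∈ S)
        (univ.filter fun S => ∃ j, (i, j) ∈ S) (by simp) (codedLen (segB α π d))] at this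
      simpa [Nat.card_eq_fintype_card, ZMod.card, Finset.prod_pow_eq_pow_sum,
        pow_add] using this)
  replace eH := fun i => (eH i).some
  replace eU := fun u => (eU u).some
  replace eS := eS.some
  replace eM := fun i => (eM i).some
  let plH : Fin K₁ → Files N F → (Fin mH → ZMod 2) := fun i w => eH i (helperCache π i w)
  let plU : User K₁ K₂ → Files N F → (Fin mU → ZMod 2) := fun u w => eU u (userCache π u w)
  let srv : Demand K₁ K₂ N → Files N F → _ := fun d w => eS ⟨d, serverMsg seg α π d w⟩
  let hlp : Fin K₁ → Demand K₁ K₂ N → Files N F → _ :=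
    fun i d w => eM i ⟨d, helperMsg α π d i w⟩
  -- Helpers and users look for some demand and library that explain what they see.
  let c : Code K₁ K₂ N F mH mU (Fintype.card (Demand K₁ K₂ N) + LS)
      (Fintype.card (Demand K₁ K₂ N) + LH) :=
    { placeHelper := plH
      placeUser := plU
      server := srv
      helper := fun i _ y z =>
        if h : ∃ x : Demand K₁ K₂ N × Files N F, srv x.1 x.2 = y ∧ plH i x.2 = z then
          hlp i h.choose.1 h.choose.2 else 0
      decode := fun u n y z =>
        if h : ∃ x : Demand K₁ K₂ N × Files N F, hlp u.1 x.1 x.2 = y ∧ plU u x.2 = z then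
          h.choose.2 (h.choose.1 u) else 0 }
  refine ⟨c, fun d w u => ?_⟩
  have hhelper : ∀ i r, c.helper i r (srv d w) (plH i w) = hlp i d w := fun i r => by
    have h : ∃ x : Demand K₁ K₂ N × Files N F, srv x.1 x.2 = srv d w ∧ plH i x.2 = plH i w :=
      ⟨(d, w), rfl, rfl⟩
    obtain ⟨h1, h2⟩ := h.choose_spec
    have hval : c.helper i r (srv d w) (plH i w) = hlp i h.choose.1 h.choose.2 := dif_pos h
    rw [hval]
    generalize h.choose = x at h1 h2
    obtain ⟨d', w'⟩ := x
    have h3 := eS.injective h1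
    obtain ⟨rfl, h4⟩ := Sigma.mk.inj_iff.1 h3
    exact congrArg (fun z => eM i ⟨_, z⟩)
      ((hdel _).1 i w' w (eq_of_heq h4) ((eH i).injective h2))
  have hdecode : ∀ n, c.decode u n (hlp u.1 d w) (plU u w) = w (d u) := fun n => by
    have h : ∃ x : Demand K₁ K₂ N × Files N F,
        hlp u.1 x.1 x.2 = hlp u.1 d w ∧ plU u x.2 = plU u w := ⟨(d, w), rfl, rfl⟩
    obtain ⟨h1, h2⟩ := h.choose_spec
    have hval : c.decode u n (hlp u.1 d w) (plU u w) = h.choose.2 (h.choose.1 u) := dif_pos h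
    rw [hval]
    generalize h.choose = x at h1 h2
    obtain ⟨d', w'⟩ := x
    have h3 := (eM u.1).injective h1
    obtain ⟨rfl, h4⟩ := Sigma.mk.inj_iff.1 h3
    exact (hdel _).2 u w' w (eq_of_heq h4) ((eU u).injective h2)
  change c.decode u (d u) (c.helper u.1 _ (srv d w) (plH u.1 w)) (plU u w) = _
  rw [hhelper, hdecode]

end Delivery

/-- If the scheme has rates `R₁`, `R₂`, this pair lies in the feasible region: for large `F` some
placement has nearly these rates, and it is used deterministically. -/
lemma mem_feasibleRegion_of_hasRates {K₁ K₂ N : ℕ} {M₁ M₂ α β : ℝ} (hN : 1 ≤ N)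
    (hM₁ : 0 ≤ M₁) (hM₂ : 0 ≤ M₂) (hβ : β ∈ Set.Icc (0 : ℝ) 1)
    {seg : (F : ℕ) → SegmentRule K₁ K₂ N F} {R₁ R₂ : ℝ}
    (hdel : ∀ F π d, DeliveryWorks (seg F) α π d)
    (h : HasRates K₁ K₂ N M₁ M₂ α β seg R₁ R₂) :
    (R₁, R₂) ∈ feasibleRegion K₁ K₂ N M₁ M₂ := by
  classical
  rw [feasibleRegion, Metric.mem_closure_iff]
  intro δ hδ
  refine ⟨(R₁ + δ / 2, R₂ + δ / 2), fun ε hε => ?_, ?_⟩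
  · have h1 := (h (δ / 4) (by positivity)).eventually (lt_mem_nhds zero_lt_one)
    have h2 : ∀ᶠ F : ℕ in atTop, (Fintype.card (Demand K₁ K₂ N) : ℝ) / (δ / 4) ≤ F :=
      tendsto_natCast_atTop_atTop.eventually_ge_atTop _
    obtain ⟨F₀, hF₀⟩ := eventually_atTop.1 ((h1.and h2).and (eventually_ge_atTop 1))
    refine ⟨F₀, fun F hF => ?_⟩
    obtain ⟨⟨hpos, hbig⟩, hF1⟩ := hF₀ F hF
    have hFpos : (0 : ℝ) < F := by exact_mod_cast hF1
    obtain ⟨π, hπ⟩ : ({π ∈ placements K₁ K₂ N M₁ M₂ α β F |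
        RatesWithin (seg F) α R₁ R₂ (δ / 4) π} : Finset _).Nonempty := by
      rw [Finset.nonempty_iff_ne_empty]
      intro h0
      simp [h0] at hpos
    obtain ⟨hmem, hrate⟩ := Finset.mem_filter.1 hπ
    obtain ⟨hfH, hfU⟩ := fitsMemory_of_mem_placements hN hM₁ hM₂ hβ hmem
    obtain ⟨c, hc⟩ := exists_code (seg F) α π (hdel F π) (mH := ⌊M₁ * F⌋₊) (mU := ⌊M₂ * F⌋₊)
      (LS := univ.sup fun d => serverLen (seg F) α π d)
      (LH := univ.sup fun d => univ.sup (helperLen α π d))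
      (fun i => Nat.le_floor (hfH i)) (fun u => Nat.le_floor (hfU u))
      (fun d => Finset.le_sup (f := fun d => serverLen (seg F) α π d) (mem_univ d))
      (fun d i => (Finset.le_sup (f := helperLen α π d) (mem_univ i)).trans
        (Finset.le_sup (f := fun d => univ.sup (helperLen α π d)) (mem_univ d)))
    have hcard : (Fintype.card (Demand K₁ K₂ N) : ℝ) ≤ δ / 4 * F := by
      rwa [div_le_iff₀' (by positivity)] at hbig
    have : Nonempty (Demand K₁ K₂ N) := ⟨fun _ => ⟨0, hN⟩⟩
    have hsup : ∀ (g : Demand K₁ K₂ N → ℕ) (R : ℝ),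
        (∀ d, |(g d : ℝ) / F - R| ≤ δ / 4) →
        ((Fintype.card (Demand K₁ K₂ N) + univ.sup g : ℕ) : ℝ) ≤ (R + δ / 2) * F := by
      intro g R hg
      obtain ⟨d, -, hd⟩ := Finset.exists_mem_eq_sup univ univ_nonempty g
      rw [hd]
      have := (abs_le.1 (hg d)).2
      rw [sub_le_iff_le_add, div_le_iff₀ hFpos] at this
      push_cast
      linarith
    refine ⟨_, _, _, _, c, Nat.floor_le (by positivity), Nat.floor_le (by positivity),
      hsup _ _ fun d => (hrate d).1, hsup _ _ fun d => (hrate d).2, fun d => ?_⟩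
    simp [Code.errorProb, hc, hε.le]
  · rw [Prod.dist_eq]
    simp only [Real.dist_eq, sub_add_cancel_left, abs_neg, max_self]
    rw [abs_of_pos (by positivity)]
    linarith

/-! ### The rate function -/

section Rates

lemma mauRate_nonneg {p : ℝ} (hp : 0 ≤ p) (hp1 : p ≤ 1) (K : ℕ) : 0 ≤ mauRate p K := by
  unfold mauRate
  split_ifs with h
  · positivity
  · have : (1 - p) ^ K ≤ 1 := pow_le_one₀ (by linarith) (by linarith)
    exact mul_nonneg (div_nonneg (by linarith) hp) (by linarith)

lemma frac_nonneg {M : ℝ} (hM : 0 ≤ M) (N : ℕ) : 0 ≤ frac M N := le_min zero_le_one (by positivity)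

lemma frac_le_one (M : ℝ) (N : ℕ) : frac M N ≤ 1 := min_le_left _ _

/-- The asymptotic length of the coded block of the set `S`, relative to the part of the file, when
each of `K` nodes caches a fraction `p` of that part. -/
def blockRate {ι : Type} (p : ℝ) (K : ℕ) (S : Finset ι) : ℝ :=
  if S.Nonempty then p ^ (#S - 1) * (1 - p) ^ (K - (#S - 1)) else 0

lemma sum_powerset_blockRate {ι : Type} [DecidableEq ι] (A : Finset ι) (p : ℝ) {K : ℕ}
    (hK : #A ≤ K) :
    ∑ S ∈ A.powerset, blockRate p K S = (1 - p) ^ (K - #A) * mauRate p #A := by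
  by_cases hp : p = 0
  · subst hp
    have : ∀ S ∈ A.powerset, blockRate 0 K S = if #S = 1 then (1 : ℝ) else 0 := fun S _ => by
      unfold blockRate
      rcases S.eq_empty_or_nonempty with rfl | h
      · simp
      · have := h.card_pos
        rw [if_pos h]
        by_cases h1 : #S = 1
        · simp [h1]
        · rw [if_neg h1, zero_pow (by omega), zero_mul]
    rw [Finset.sum_congr rfl this, ← Finset.sum_filter, ← Finset.powersetCard_eq_filter]
    simp [mauRate]
  · have hterm : ∀ S ∈ A.powerset.erase ∅, blockRate p K S =
        (1 - p) ^ (K - #A) * ((1 - p) / p) * (p ^ #S * (1 - p) ^ (#A - #S)) := fun S hS => by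
      obtain ⟨h0, hS⟩ := Finset.mem_erase.1 hS
      have h : S.Nonempty := Finset.nonempty_iff_ne_empty.2 h0
      have hc := Finset.card_le_card (Finset.mem_powerset.1 hS)
      obtain ⟨c, hc'⟩ := Nat.exists_eq_add_of_lt h.card_pos
      have e : K - (#S - 1) = (K - #A) + (#A - #S) + 1 := by omega
      rw [blockRate, if_pos h, e, hc', pow_add _ _ 1, pow_add (1 - p)]
      simp only [zero_add, Nat.add_sub_cancel, pow_succ]
      field_simp
    have hempty : blockRate p K (∅ : Finset ι) = 0 := by simp [blockRate]
    rw [← Finset.sum_erase _ hempty, Finset.sum_congr rfl hterm, ← Finset.mul_sum,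
      Finset.sum_erase_eq_sub (Finset.empty_mem_powerset A), Finset.sum_pow_mul_eq_add_pow]
    simp [mauRate, hp]
    ring

lemma sum_blockRate {ι : Type} [Fintype ι] [DecidableEq ι] (p : ℝ) :
    ∑ S : Finset ι, blockRate p (Fintype.card ι) S = mauRate p (Fintype.card ι) := by
  have := sum_powerset_blockRate (univ : Finset ι) p (K := Fintype.card ι) le_rfl
  simpa using this

/-- Among the blocks for all users, those for sets that contain a user of a given helper have the
total rate of a system with the users of that helper alone. -/
lemma sum_blockRate_meeting (K₁ K₂ : ℕ) (i : Fin K₁) (p : ℝ) :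
    ∑ S : Finset (User K₁ K₂) with ∃ j, (i, j) ∈ S, blockRate p (K₁ * K₂) S = mauRate p K₂ := by
  set A : Finset (User K₁ K₂) := ({i}ᶜ : Finset (Fin K₁)) ×ˢ univ with hA
  have hcard : #A = (K₁ - 1) * K₂ := by simp [hA, Finset.card_compl]
  have hK₁ : 0 < K₁ := i.pos
  obtain ⟨m, rfl⟩ : ∃ m, K₁ = m + 1 := ⟨K₁ - 1, by omega⟩
  have hle : #A ≤ (m + 1) * K₂ := by rw [hcard]; exact Nat.mul_le_mul_right _ (by omega)
  have htot := sum_blockRate (ι := User (m + 1) K₂) p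
  rw [← Finset.sum_filter_add_sum_filter_not univ
    (fun S : Finset (User (m + 1) K₂) => ∃ j, (i, j) ∈ S)] at htot
  have hcompl : (univ.filter fun S : Finset (User (m + 1) K₂) => ¬ ∃ j, (i, j) ∈ S) =
      A.powerset := by
    ext S
    simp only [Finset.mem_filter, Finset.mem_univ, true_and, Finset.mem_powerset, not_exists]
    constructor
    · rintro h ⟨i', j⟩ hm
      simp only [hA, Finset.mem_product, Finset.mem_compl, Finset.mem_singleton,
        Finset.mem_univ, and_true]
      rintro rfl
      exact h j hm
    · intro h j hm
      simpa [hA] using h hm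
  simp only [Fintype.card_prod, Fintype.card_fin] at htot
  rw [hcompl, sum_powerset_blockRate A p hle] at htot
  rw [eq_sub_of_add_eq htot, hcard]
  have e : (m + 1) * K₂ - (m + 1 - 1) * K₂ = K₂ := by
    rw [Nat.add_sub_cancel, add_mul, one_mul, Nat.add_sub_cancel_left]
  rw [e, Nat.add_sub_cancel]
  unfold mauRate
  split_ifs with hp
  · subst hp; push_cast; simp; ring
  · rw [add_mul, pow_add, one_mul]
    ring

/-- The fractions of a part that are cached exactly at `S \ {k}` multiply to the rate of the
block `S`. -/
lemma prod_erase_eq_blockRate {ι : Type} [Fintype ι] [DecidableEq ι] (p : ℝ) {S : Finset ι} {k : ι}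
    (hk : k ∈ S) :
    ∏ l : ι, (if l ∈ S.erase k then p else 1 - p) = blockRate p (Fintype.card ι) S := by
  have : (univ.filter fun l => l ∉ S.erase k) = (S.erase k)ᶜ := by
    ext; rw [Finset.mem_filter_univ, Finset.mem_compl]
  rw [Finset.prod_ite, Finset.prod_const, Finset.prod_const, this, Finset.filter_mem_eq_inter,
    Finset.univ_inter, Finset.card_compl, Finset.card_erase_of_mem hk, blockRate, if_pos ⟨k, hk⟩]

lemma rateH₁_le_rateG₁ (K₁ K₂ N : ℕ) {M₁ M₂ α β : ℝ} (hM₁ : 0 ≤ M₁) (hM₂ : 0 ≤ M₂)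
    (hα : 0 ≤ α) (hβ : 0 ≤ β) : rateH₁ K₁ K₂ N M₁ M₂ α β ≤ rateG₁ K₁ K₂ N M₁ M₂ α β := by
  unfold rateH₁ rateG₁ rateSC₁ rateA₁
  have h0 : 0 ≤ mauRate (frac (M₁ / α) N) K₁ :=
    mauRate_nonneg (frac_nonneg (by positivity) _) (frac_le_one _ _) _
  have h1 : 0 ≤ frac (β * M₂ / α) N := frac_nonneg (by positivity) _
  gcongr
  exact mul_le_of_le_one_right (by positivity) (by linarith)

lemma mul_mauRate_frac {M a : ℝ} {N : ℕ} (hN : 1 ≤ N) (ha : 0 < a) (hM : 0 < M)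
    (hle : M ≤ a * N) (K : ℕ) :
    frac (M / a) N = M / (a * N) ∧
      mauRate (frac (M / a) N) K =
        (1 - M / (a * N)) * (a * N / M) * (1 - (1 - M / (a * N)) ^ K) := by
  have hN' : (0 : ℝ) < N := by exact_mod_cast hN
  have hf : frac (M / a) N = M / (a * N) := by
    rw [frac, div_div, min_eq_right]
    rwa [div_le_one (by positivity)]
  refine ⟨hf, ?_⟩
  rw [hf, mauRate, if_neg (by positivity), div_eq_mul_inv (1 - M / (a * N)), inv_div]

end Rates

/-! ### Convergence in probability along finite uniform sample spaces -/

section Convergence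

variable {Ω : ℕ → Type}

open Classical in
/-- The events `E F` hold with probability tending to `1` as `F → ∞`, for the uniform distributions
on the finite sets `s F`. -/
def WithHighProb (s : (F : ℕ) → Finset (Ω F)) (E : (F : ℕ) → Ω F → Prop) : Prop :=
  Tendsto (fun F => (#{x ∈ s F | ¬ E F x} : ℝ) / #(s F)) atTop (𝓝 0)

/-- The random variables `X F` converge to `c` in probability, for the uniform distributions on the
finite sets `s F`. -/
def TendstoInProb (s : (F : ℕ) → Finset (Ω F)) (X : (F : ℕ) → Ω F → ℝ) (c : ℝ) : Prop :=
  ∀ ε : ℝ, 0 < ε → WithHighProb s fun F x => |X F x - c| ≤ ε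

variable {s : (F : ℕ) → Finset (Ω F)}

lemma WithHighProb.mono {E E' : (F : ℕ) → Ω F → Prop} (h : WithHighProb s E)
    (hE : ∀ F x, E F x → E' F x) : WithHighProb s E' := by
  classical
  refine squeeze_zero (fun F => by positivity) (fun F => ?_) h
  gcongr with x
  exact hE F x

lemma WithHighProb.and {E E' : (F : ℕ) → Ω F → Prop} (h : WithHighProb s E)
    (h' : WithHighProb s E') : WithHighProb s fun F x => E F x ∧ E' F x := by
  classical
  refine squeeze_zero (fun F => by positivity) (fun F => ?_) (by simpa using Tendsto.add h h')
  rw [← add_div]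
  gcongr
  rw [← Nat.cast_add, Nat.cast_le]
  refine (Finset.card_le_card fun x hx => ?_).trans (Finset.card_union_le _ _)
  simp only [Finset.mem_filter, Finset.mem_union] at hx ⊢
  tauto

lemma withHighProb_of_forall {E : (F : ℕ) → Ω F → Prop} (h : ∀ F x, E F x) :
    WithHighProb s E := by
  simp [WithHighProb, h]

lemma WithHighProb.forall_mem {ι : Type} (t : Finset ι) {E : ι → (F : ℕ) → Ω F → Prop}
    (h : ∀ i ∈ t, WithHighProb s (E i)) : WithHighProb s fun F x => ∀ i ∈ t, E i F x := by
  classical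
  induction t using Finset.induction_on with
  | empty => exact withHighProb_of_forall (by simp)
  | insert a t _ ih =>
    refine ((h a (Finset.mem_insert_self _ _)).and
      (ih fun i hi => h i (Finset.mem_insert_of_mem hi))).mono fun F x hx => ?_
    simpa using hx

lemma WithHighProb.forall {ι : Type} [Fintype ι] {E : ι → (F : ℕ) → Ω F → Prop}
    (h : ∀ i, WithHighProb s (E i)) : WithHighProb s fun F x => ∀ i, E i F x :=
  (WithHighProb.forall_mem univ fun i _ => h i).mono fun _ _ hx i => hx i (mem_univ i)

open Classical in
lemma WithHighProb.tendsto_one {E : (F : ℕ) → Ω F → Prop} (h : WithHighProb s E)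
    (hs : ∀ F, (s F).Nonempty) :
    Tendsto (fun F => (#{x ∈ s F | E F x} : ℝ) / #(s F)) atTop (𝓝 1) := by
  have h1 : Tendsto (fun F => 1 - (#{x ∈ s F | ¬ E F x} : ℝ) / #(s F)) atTop (𝓝 (1 - 0)) :=
    tendsto_const_nhds.sub h
  rw [sub_zero] at h1
  refine h1.congr fun F => ?_
  have hpos : (#(s F) : ℝ) ≠ 0 := by exact_mod_cast (hs F).card_pos.ne'
  have hadd : (#{x ∈ s F | E F x} : ℝ) + #{x ∈ s F | ¬ E F x} = #(s F) := by
    exact_mod_cast Finset.card_filter_add_card_filter_not (s := s F) (E F)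
  rw [eq_div_iff hpos, sub_mul, div_mul_cancel₀ _ hpos]
  linarith

lemma tendstoInProb_const (c : ℝ) : TendstoInProb s (fun _ _ => c) c := fun ε hε =>
  withHighProb_of_forall fun _ _ => by simpa using hε.le

lemma TendstoInProb.add {X Y : (F : ℕ) → Ω F → ℝ} {a b : ℝ} (hX : TendstoInProb s X a)
    (hY : TendstoInProb s Y b) : TendstoInProb s (fun F x => X F x + Y F x) (a + b) :=
  fun ε hε => ((hX (ε / 2) (by positivity)).and (hY (ε / 2) (by positivity))).mono
    fun F x ⟨h1, h2⟩ => by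
      rw [add_sub_add_comm]
      exact (abs_add_le _ _).trans (by linarith)

lemma TendstoInProb.sum {ι : Type} (t : Finset ι) {X : ι → (F : ℕ) → Ω F → ℝ} {a : ι → ℝ}
    (h : ∀ i ∈ t, TendstoInProb s (X i) (a i)) :
    TendstoInProb s (fun F x => ∑ i ∈ t, X i F x) (∑ i ∈ t, a i) := by
  classical
  induction t using Finset.induction_on with
  | empty => simpa using tendstoInProb_const 0
  | insert i t hi ih =>
    simp only [Finset.sum_insert hi]
    exact (h i (Finset.mem_insert_self _ _)).add
      (ih fun k hk => h k (Finset.mem_insert_of_mem hk))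

lemma TendstoInProb.sup {ι : Type} {t : Finset ι} (ht : t.Nonempty)
    {X : ι → (F : ℕ) → Ω F → ℕ} {a : ℝ}
    (h : ∀ i ∈ t, TendstoInProb s (fun F x => (X i F x : ℝ) / F) a) :
    TendstoInProb s (fun F x => ((t.sup fun i => X i F x : ℕ) : ℝ) / F) a := fun ε hε =>
  (WithHighProb.forall_mem t fun i hi => h i hi ε hε).mono fun F x hx => by
    obtain ⟨i, hi, heq⟩ := Finset.exists_mem_eq_sup t ht fun i => X i F x
    simpa only [heq] using hx i hi

open Classical in
lemma card_filter_not_le_of_sum_sq_le {Ω : Type} (s : Finset Ω) (X : Ω → ℝ) {μ ε V : ℝ}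
    (hε : 0 < ε) (hV : ∑ x ∈ s, (X x - μ) ^ 2 ≤ V * #s) :
    (#{x ∈ s | ¬ |X x - μ| ≤ ε} : ℝ) * ε ^ 2 ≤ V * #s := by
  refine le_trans ?_ hV
  rw [← nsmul_eq_mul]
  refine (Finset.card_nsmul_le_sum {x ∈ s | ¬ |X x - μ| ≤ ε} (fun x => (X x - μ) ^ 2) (ε ^ 2)
    fun x hx => ?_).trans (Finset.sum_le_sum_of_subset_of_nonneg (Finset.filter_subset _ _)
      fun _ _ _ => sq_nonneg _)
  rw [← sq_abs (X x - μ)]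
  have := (Finset.mem_filter.1 hx).2
  gcongr
  linarith

/-- Chebyshev's inequality: a variance of order `F` is negligible on the scale `F`. -/
lemma tendstoInProb_of_variance_le {X : (F : ℕ) → Ω F → ℝ} {μ : ℕ → ℝ} {c : ℝ}
    (hV : ∀ F, ∑ x ∈ s F, (X F x - μ F) ^ 2 ≤ F * #(s F))
    (hμ : Tendsto (fun F => μ F / F) atTop (𝓝 c)) :
    TendstoInProb s (fun F x => X F x / F) c := by
  classical
  intro ε hε
  have hlim : Tendsto (fun F : ℕ => ((ε / 2) ^ 2)⁻¹ * (1 / (F : ℝ))) atTop (𝓝 0) := by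
    simpa only [mul_zero] using
      (tendsto_one_div_atTop_nhds_zero_nat (𝕜 := ℝ)).const_mul ((ε / 2) ^ 2)⁻¹
  have hclose : ∀ᶠ F : ℕ in atTop, |μ F / F - c| ≤ ε / 2 :=
    (Metric.tendsto_nhds.1 hμ (ε / 2) (by positivity)).mono fun F hF => by
      rw [Real.dist_eq] at hF; exact hF.le
  refine squeeze_zero' (Eventually.of_forall fun F => by positivity) ?_ hlim
  filter_upwards [hclose, eventually_ge_atTop 1] with F hF hF1
  have hFpos : (0 : ℝ) < F := by exact_mod_cast hF1
  rcases (s F).eq_empty_or_nonempty with h0 | h0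
  · simp [h0]; positivity
  have hpos : (0 : ℝ) < #(s F) := by exact_mod_cast h0.card_pos
  have h1 := card_filter_not_le_of_sum_sq_le (s F) (X F) (ε := ε / 2 * F) (by positivity) (hV F)
  have h2 : (#{x ∈ s F | ¬ |X F x / F - c| ≤ ε} : ℝ) ≤
      #{x ∈ s F | ¬ |X F x - μ F| ≤ ε / 2 * F} := by
    rw [Nat.cast_le]
    refine Finset.card_le_card (Finset.monotone_filter_right _ fun x _ hx hle => hx ?_)
    have h3 : |X F x / F - μ F / F| ≤ ε / 2 := by
      rw [← sub_div, abs_div, abs_of_pos hFpos, div_le_iff₀ hFpos]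
      exact hle
    calc |X F x / F - c| ≤ |X F x / F - μ F / F| + |μ F / F - c| := abs_sub_le _ _ _
      _ ≤ ε := by linarith
  calc (#{x ∈ s F | ¬ |X F x / F - c| ≤ ε} : ℝ) / #(s F)
      ≤ (#{x ∈ s F | ¬ |X F x - μ F| ≤ ε / 2 * F} : ℝ) / #(s F) := by gcongr
    _ ≤ ((ε / 2) ^ 2)⁻¹ * (1 / (F : ℝ)) := by
        rw [div_le_iff₀ hpos, ← mul_le_mul_iff_left₀ (show 0 < (ε / 2 * F) ^ 2 by positivity)]
        refine h1.trans (le_of_eq ?_)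
        field_simp

end Convergence

/-! ### Second moments of negatively correlated counts -/

section SecondMoment

open Classical in
/-- If the events `E · b`, `b ∈ P`, have probability `r` each and are pairwise negatively
correlated, the variance of the number of those that occur is at most `#P`. -/
lemma sum_sq_card_filter_sub_le {Ω B : Type} (s : Finset Ω) (P : Finset B) (E : Ω → B → Prop)
    {r : ℝ} (hr1 : r ≤ 1) (h1 : ∀ b ∈ P, (#{x ∈ s | E x b} : ℝ) = r * #s)
    (h2 : ∀ b ∈ P, ∀ b' ∈ P, b ≠ b' → (#{x ∈ s | E x b ∧ E x b'} : ℝ) ≤ r ^ 2 * #s) :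
    ∑ x ∈ s, ((#{b ∈ P | E x b} : ℝ) - #P * r) ^ 2 ≤ #P * #s := by
  have hX : ∑ x ∈ s, (#{b ∈ P | E x b} : ℝ) = #P * r * #s := by
    have : ∑ x ∈ s, #{b ∈ P | E x b} = ∑ b ∈ P, #{x ∈ s | E x b} :=
      Finset.sum_card_bipartiteAbove_eq_sum_card_bipartiteBelow E
    have h := congrArg (Nat.cast (R := ℝ)) this
    push_cast at h
    rw [h, Finset.sum_congr rfl h1]
    simp [mul_assoc]
  have hX2 : ∑ x ∈ s, (#{b ∈ P | E x b} : ℝ) ^ 2 ≤ #P * r * #s + (#P * r) ^ 2 * #s := by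
    have hsq : ∀ x ∈ s, (#{b ∈ P | E x b} : ℝ) ^ 2 =
        ∑ y ∈ P ×ˢ P, if E x y.1 ∧ E x y.2 then (1 : ℝ) else 0 := fun x _ => by
      rw [← Finset.sum_filter, Finset.filter_product, Finset.sum_const, Finset.card_product]
      simp [sq]
    rw [Finset.sum_congr rfl hsq, Finset.sum_comm]
    have hb : ∀ y ∈ P ×ˢ P, (∑ x ∈ s, if E x y.1 ∧ E x y.2 then (1 : ℝ) else 0) ≤
        (if y.1 = y.2 then r * #s else 0) + r ^ 2 * #s := fun y hy => by
      obtain ⟨hy1, hy2⟩ := Finset.mem_product.1 hy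
      rw [← Finset.sum_filter, Finset.sum_const, nsmul_eq_mul, mul_one]
      split_ifs with h
      · have := h1 _ hy1
        rw [← h]
        simp only [and_self]
        rw [this]
        have : 0 ≤ r ^ 2 * #s := by positivity
        linarith
      · rw [zero_add]
        exact h2 _ hy1 _ hy2 h
    refine (Finset.sum_le_sum hb).trans (le_of_eq ?_)
    rw [Finset.sum_add_distrib, Finset.sum_product]
    simp only [Finset.sum_ite_eq, Finset.sum_const, Finset.card_product, nsmul_eq_mul]
    rw [Finset.sum_congr rfl fun b hb => if_pos hb]
    simp
    ring
  have hexp : ∑ x ∈ s, ((#{b ∈ P | E x b} : ℝ) - #P * r) ^ 2 =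
      ∑ x ∈ s, (#{b ∈ P | E x b} : ℝ) ^ 2 - 2 * (#P * r) * ∑ x ∈ s, (#{b ∈ P | E x b} : ℝ) +
        #s * (#P * r) ^ 2 := by
    simp only [sub_sq, Finset.sum_add_distrib, Finset.sum_sub_distrib, Finset.mul_sum]
    rw [Finset.sum_const, nsmul_eq_mul]
    congr 2
    exact Finset.sum_congr rfl fun x _ => by ring
  rw [hexp, hX]
  have : (#P : ℝ) * r * #s ≤ #P * #s := by
    rw [mul_right_comm]
    exact mul_le_of_le_one_right (by positivity) hr1
  nlinarith

end SecondMoment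

/-! ### Uniform subsets of prescribed size -/

section Hypergeometric

variable {B : Type} [DecidableEq B]

lemma card_powersetCard_filter_notMem (P : Finset B) (k : ℕ) {b : B} (hb : b ∈ P) :
    #{A ∈ P.powersetCard k | b ∉ A} = (#P - 1).choose k := by
  rw [← Finset.card_erase_of_mem hb, ← Finset.card_powersetCard]
  congr 1
  ext A
  simp only [Finset.mem_filter, Finset.mem_powersetCard, Finset.subset_erase]
  tauto

lemma card_powersetCard_filter_notMem_notMem (P : Finset B) (k : ℕ) {b b' : B} (hb : b ∈ P)
    (hb' : b' ∈ P) (hne : b ≠ b') :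
    #{A ∈ P.powersetCard k | b ∉ A ∧ b' ∉ A} = (#P - 2).choose k := by
  have : #((P.erase b).erase b') = #P - 2 := by
    rw [Finset.card_erase_of_mem (Finset.mem_erase.2 ⟨hne.symm, hb'⟩),
      Finset.card_erase_of_mem hb]
    omega
  rw [← this, ← Finset.card_powersetCard]
  congr 1
  ext A
  simp only [Finset.mem_filter, Finset.mem_powersetCard, Finset.subset_erase]
  tauto

/-- The probability that a uniform `k`-subset of an `m`-set contains a given element (`v` true), or
that it does not (`v` false). -/
def pickProb (k m : ℕ) (v : Prop) [Decidable v] : ℝ := if v then (k : ℝ) / m else 1 - (k : ℝ) / m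

lemma pickProb_nonneg {k m : ℕ} (h : k ≤ m) (v : Prop) [Decidable v] : 0 ≤ pickProb k m v := by
  have : (k : ℝ) / m ≤ 1 := div_le_one_of_le₀ (by exact_mod_cast h) (by positivity)
  unfold pickProb
  split_ifs
  · positivity
  · linarith

lemma pickProb_le_one {k m : ℕ} (h : k ≤ m) (v : Prop) [Decidable v] : pickProb k m v ≤ 1 := by
  have : (k : ℝ) / m ≤ 1 := div_le_one_of_le₀ (by exact_mod_cast h) (by positivity)
  unfold pickProb
  split_ifs
  · exact this
  · have : 0 ≤ (k : ℝ) / m := by positivity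
    linarith

lemma cast_choose_pred {k m : ℕ} (hk : k ≤ m) (hm : 0 < m) :
    ((m - 1).choose k : ℝ) = (1 - (k : ℝ) / m) * m.choose k := by
  obtain ⟨n, rfl⟩ : ∃ n, m = n + 1 := ⟨m - 1, by omega⟩
  have h := congrArg (Nat.cast (R := ℝ)) (Nat.choose_mul_succ_eq n k)
  push_cast [Nat.cast_sub hk] at h
  have : ((n : ℝ) + 1) ≠ 0 := by positivity
  rw [Nat.add_sub_cancel]
  push_cast
  field_simp
  linarith

lemma card_powersetCard_filter_mem_iff {P : Finset B} {k : ℕ} (hk : k ≤ #P) {b : B} (hb : b ∈ P)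
    (v : Prop) [Decidable v] :
    (#{A ∈ P.powersetCard k | b ∈ A ↔ v} : ℝ) = pickProb k #P v * #(P.powersetCard k) := by
  have hnot : (#{A ∈ P.powersetCard k | b ∉ A} : ℝ) =
      (1 - (k : ℝ) / #P) * #(P.powersetCard k) := by
    rw [card_powersetCard_filter_notMem P k hb, Finset.card_powersetCard,
      cast_choose_pred hk (Finset.card_pos.2 ⟨b, hb⟩)]
  by_cases hv : v
  · simp only [hv, iff_true, pickProb, if_true]
    have hadd : (#{A ∈ P.powersetCard k | b ∈ A} : ℝ) + #{A ∈ P.powersetCard k | b ∉ A} =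
        #(P.powersetCard k) := by
      exact_mod_cast Finset.card_filter_add_card_filter_not (s := P.powersetCard k) (b ∈ ·)
    linarith
  · simpa only [hv, iff_false, pickProb, if_false] using hnot

/-- Distinct elements are negatively correlated in a uniform subset of prescribed size. -/
lemma card_powersetCard_filter_mem_iff_and_le {P : Finset B} {k : ℕ} (hk : k ≤ #P) {b b' : B}
    (hb : b ∈ P) (hb' : b' ∈ P) (hne : b ≠ b') (v : Prop) [Decidable v] :
    (#{A ∈ P.powersetCard k | (b ∈ A ↔ v) ∧ (b' ∈ A ↔ v)} : ℝ) ≤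
      pickProb k #P v ^ 2 * #(P.powersetCard k) := by
  have hm : 2 ≤ #P := by
    rw [← Finset.card_pair hne]
    exact Finset.card_le_card (Finset.insert_subset hb (Finset.singleton_subset_iff.2 hb'))
  set a : ℝ := 1 - (k : ℝ) / #P with ha
  have ha0 : 0 ≤ a := by
    have : (k : ℝ) / #P ≤ 1 := div_le_one_of_le₀ (by exact_mod_cast hk) (by positivity)
    linarith
  have hone : ∀ c ∈ P, (#{A ∈ P.powersetCard k | c ∉ A} : ℝ) = a * #(P.powersetCard k) :=
    fun c hc => by
      rw [card_powersetCard_filter_notMem P k hc, Finset.card_powersetCard,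
        cast_choose_pred hk (by omega)]
  have hnot : (#{A ∈ P.powersetCard k | b ∉ A ∧ b' ∉ A} : ℝ) ≤ a ^ 2 * #(P.powersetCard k) := by
    rw [card_powersetCard_filter_notMem_notMem P k hb hb' hne, Finset.card_powersetCard]
    rcases hk.eq_or_lt with h | h
    · rw [Nat.choose_eq_zero_of_lt (by omega)]
      simp only [Nat.cast_zero]
      positivity
    · have e1 := cast_choose_pred (k := k) (m := #P - 1) (by omega) (by omega)
      rw [Nat.sub_sub, cast_choose_pred hk (by omega)] at e1
      rw [e1, ← mul_assoc]
      have h1 : (0 : ℝ) < ((#P - 1 : ℕ) : ℝ) := by exact_mod_cast (by omega : 0 < #P - 1)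
      have h2 : (k : ℝ) / #P ≤ (k : ℝ) / ((#P - 1 : ℕ) : ℝ) := by
        gcongr
        omega
      gcongr
      rw [sq]
      gcongr
      linarith
  by_cases hv : v
  · simp only [hv, iff_true, pickProb, if_true]
    -- inclusion and exclusion turns the bound for two missing elements into the one for two
    -- contained elements
    have hincl : (#{A ∈ P.powersetCard k | b ∈ A ∧ b' ∈ A} : ℝ) +
        #{A ∈ P.powersetCard k | b ∉ A} + #{A ∈ P.powersetCard k | b' ∉ A} =
        #(P.powersetCard k) + #{A ∈ P.powersetCard k | b ∉ A ∧ b' ∉ A} := by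
      have h1 := Finset.card_filter_add_card_filter_not (s := P.powersetCard k)
        (fun A => b ∈ A ∧ b' ∈ A)
      have h2 := Finset.card_union_add_card_inter {A ∈ P.powersetCard k | b ∉ A}
        {A ∈ P.powersetCard k | b' ∉ A}
      rw [← Finset.filter_or, ← Finset.filter_and] at h2
      simp only [not_and_or] at h1
      exact_mod_cast (by omega : _ = _)
    rw [hone b hb, hone b' hb'] at hincl
    have : (k : ℝ) / #P = 1 - a := by rw [ha]; ring
    rw [this]
    nlinarith
  · simpa only [hv, iff_false, pickProb, if_false] using hnot

end Hypergeometric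

/-! ### Patterns of independent picks -/

section Patterns

variable {κ B : Type} [Fintype κ] [DecidableEq κ] [DecidableEq B]

/-- Independence: the number of families in a product set with constrained coordinates in `J`. -/
lemma card_piFinset_filter_forall_mem {X : Type} (t : κ → Finset X) (J : Finset κ)
    (E : κ → X → Prop) [∀ k, DecidablePred (E k)] :
    (#{ω ∈ Fintype.piFinset t | ∀ k ∈ J, E k (ω k)} : ℝ) =
      ∏ k, if k ∈ J then (#{A ∈ t k | E k A} : ℝ) else #(t k) := by
  have : {ω ∈ Fintype.piFinset t | ∀ k ∈ J, E k (ω k)} =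
      Fintype.piFinset fun k => if k ∈ J then {A ∈ t k | E k A} else t k := by
    ext ω
    simp only [Finset.mem_filter, Fintype.mem_piFinset]
    constructor
    · rintro ⟨h1, h2⟩ k
      split_ifs with hk
      · exact Finset.mem_filter.2 ⟨h1 k, h2 k hk⟩
      · exact h1 k
    · intro h
      refine ⟨fun k => ?_, fun k hk => ?_⟩
      · have := h k
        split_ifs at this
        · exact (Finset.mem_filter.1 this).1
        · exact this
      · have := h k
        rw [if_pos hk] at this
        exact (Finset.mem_filter.1 this).2
  rw [this, Fintype.card_piFinset]
  push_cast
  exact Finset.prod_congr rfl fun k _ => by split_ifs <;> rfl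

lemma prod_ite_mul_eq (J : Finset κ) (r c : κ → ℝ) :
    ∏ k, (if k ∈ J then r k * c k else c k) = (∏ k ∈ J, r k) * ∏ k, c k := by
  rw [← Finset.prod_ite_mem_eq J r, ← Finset.prod_mul_distrib]
  exact Finset.prod_congr rfl fun k _ => by split_ifs <;> simp

/-- The number of positions in `P` with a given pattern of membership in independent uniform
subsets of `P` has mean `#P` times the product of the marginal probabilities, and variance at most
`#P`. -/
lemma sum_sq_card_pattern_sub_le (t : κ → Finset (Finset B)) (J : Finset κ) (P : Finset B)
    (m : κ → ℕ) (hm : ∀ k ∈ J, m k ≤ #P) (ht : ∀ k ∈ J, t k = P.powersetCard (m k))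
    (v : κ → Prop) [DecidablePred v] :
    ∑ ω ∈ Fintype.piFinset t,
      ((#{b ∈ P | ∀ k ∈ J, b ∈ ω k ↔ v k} : ℝ) - #P * ∏ k ∈ J, pickProb (m k) #P (v k)) ^ 2 ≤
      #P * #(Fintype.piFinset t) := by
  have hcard : (#(Fintype.piFinset t) : ℝ) = ∏ k, (#(t k) : ℝ) := by
    rw [Fintype.card_piFinset]; push_cast; rfl
  have h := sum_sq_card_filter_sub_le (Fintype.piFinset t) P
    (fun ω b => ∀ k ∈ J, b ∈ ω k ↔ v k) (r := ∏ k ∈ J, pickProb (m k) #P (v k))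
    (Finset.prod_le_one (fun k hk => pickProb_nonneg (hm k hk) _)
      fun k hk => pickProb_le_one (hm k hk) _)
    (fun b hb => ?_) (fun b hb b' hb' hne => ?_)
  · convert h
  · have := card_piFinset_filter_forall_mem t J (fun k A => b ∈ A ↔ v k)
    refine Eq.trans ?_ (this.trans ?_)
    · congr!
    rw [hcard, ← prod_ite_mul_eq]
    refine Finset.prod_congr rfl fun k _ => ?_
    split_ifs with hk
    · rw [ht k hk, card_powersetCard_filter_mem_iff (hm k hk) hb]
    · rfl
  · have := card_piFinset_filter_forall_mem t J (fun k A => (b ∈ A ↔ v k) ∧ (b' ∈ A ↔ v k))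
    simp only [forall₂_and] at this
    refine (le_of_eq ?_).trans (this.le.trans ?_)
    · congr!
    rw [hcard, ← Finset.prod_pow, ← prod_ite_mul_eq]
    refine Finset.prod_le_prod (fun k _ => by split_ifs <;> positivity) fun k _ => ?_
    split_ifs with hk
    · rw [ht k hk]
      exact card_powersetCard_filter_mem_iff_and_le (hm k hk) hb hb' hne _
    · rfl

end Patterns

/-! ### The random placement -/

section RandomPlacement

variable {K₁ K₂ N F : ℕ}

/-- The independent picks of a placement: those of the helpers in the first part, of the users in
the first part, and of the users in the second part, for every file. -/
abbrev Pick (K₁ K₂ N : ℕ) :=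
  (Fin K₁ × Fin N) ⊕ (User K₁ K₂ × Fin N) ⊕ (User K₁ K₂ × Fin N)

/-- A placement, as the family of its picks. -/
def placementEquiv (K₁ K₂ N F : ℕ) :
    Placement K₁ K₂ N F ≃ (Pick K₁ K₂ N → Finset (Fin F)) where
  toFun π := Sum.elim (fun x => π.1 x.1 x.2)
    (Sum.elim (fun x => π.2.1 x.1 x.2) fun x => π.2.2 x.1 x.2)
  invFun ω := (fun i n => ω (.inl (i, n)), fun u n => ω (.inr (.inl (u, n))),
    fun u n => ω (.inr (.inr (u, n))))
  left_inv _ := rfl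
  right_inv ω := by
    funext k
    rcases k with _ | _ | _ <;> rfl

/-- The part of the files from which a pick is made. -/
def pickPart (α : ℝ) (F : ℕ) : Pick K₁ K₂ N → Finset (Fin F) :=
  Sum.elim (fun _ => firstPart α F) (Sum.elim (fun _ => firstPart α F) fun _ => secondPart α F)

/-- The memory, in units of `F` bits, from which a pick gets the share of one file. -/
def pickMem (M₁ M₂ β : ℝ) : Pick K₁ K₂ N → ℝ :=
  Sum.elim (fun _ => M₁) (Sum.elim (fun _ => β * M₂) fun _ => (1 - β) * M₂)

lemma mem_placements_iff {M₁ M₂ α β : ℝ} {π : Placement K₁ K₂ N F} :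
    π ∈ placements K₁ K₂ N M₁ M₂ α β F ↔ placementEquiv K₁ K₂ N F π ∈
      Fintype.piFinset fun k => picks (pickPart α F k) ⌊pickMem M₁ M₂ β k * F / N⌋₊ := by
  simp only [placements, Finset.mem_product, Fintype.mem_piFinset, Sum.forall,
    Prod.forall, Sum.elim_inl, Sum.elim_inr, pickPart, pickMem]
  rfl

lemma card_firstPart {α : ℝ} (hα1 : α ≤ 1) (F : ℕ) : #(firstPart α F) = ⌊α * F⌋₊ := by
  have hle : ⌊α * F⌋₊ ≤ F := by
    refine Nat.floor_le_of_le ?_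
    exact mul_le_of_le_one_left (by positivity) hα1
  rw [firstPart, Fin.card_filter_val_lt, min_eq_right hle]

lemma tendsto_card_firstPart_div {α : ℝ} (hα : α ∈ Set.Icc (0 : ℝ) 1) :
    Tendsto (fun F : ℕ => (#(firstPart α F) : ℝ) / F) atTop (𝓝 α) := by
  simp only [card_firstPart hα.2]
  exact (tendsto_nat_floor_mul_div_atTop hα.1).comp tendsto_natCast_atTop_atTop

lemma tendsto_card_secondPart_div {α : ℝ} (hα : α ∈ Set.Icc (0 : ℝ) 1) :
    Tendsto (fun F : ℕ => (#(secondPart α F) : ℝ) / F) atTop (𝓝 (1 - α)) := by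
  refine (tendsto_const_nhds.sub (tendsto_card_firstPart_div hα)).congr' ?_
  filter_upwards [eventually_ge_atTop 1] with F hF
  have hF' : (F : ℝ) ≠ 0 := by positivity
  have hle : #(firstPart α F) ≤ F := by simpa using Finset.card_le_univ (firstPart α F)
  rw [secondPart, Finset.card_compl, Fintype.card_fin, Nat.cast_sub hle, sub_div, div_self hF']

/-- The fraction of a part that one node caches tends to the value in the rate formulas. -/
lemma tendsto_min_floor_div {M a : ℝ} (hM : 0 ≤ M) (ha : 0 < a) (N : ℕ) {c : ℕ → ℕ}
    (hc : Tendsto (fun F : ℕ => (c F : ℝ) / F) atTop (𝓝 a)) :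
    Tendsto (fun F : ℕ => ((min ⌊M * F / N⌋₊ (c F) : ℕ) : ℝ) / c F) atTop
      (𝓝 (frac (M / a) N)) := by
  have h1 : Tendsto (fun F : ℕ => (⌊M * F / N⌋₊ : ℝ) / F) atTop (𝓝 (M / N)) := by
    have := (tendsto_nat_floor_mul_div_atTop (R := ℝ) (a := M / N) (by positivity)).comp
      tendsto_natCast_atTop_atTop
    simpa only [Function.comp_def, div_mul_eq_mul_div] using this
  have h2 := (h1.min hc).div hc ha.ne'
  have h3 : min (M / N) a / a = frac (M / a) N := by
    rw [frac, ← min_div_div_right ha.le, div_self ha.ne', min_comm, div_right_comm]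
  rw [h3] at h2
  refine h2.congr' ?_
  filter_upwards [eventually_ge_atTop 1] with F hF
  have hF' : (0 : ℝ) < F := by positivity
  simp only [Pi.div_apply]
  rw [min_div_div_right hF'.le, div_div_div_cancel_right₀ hF'.ne', Nat.cast_min]

/-- Law of large numbers for the set `X` of the positions with membership pattern `v` in finitely
many distinct picks `g i` from the same part of the files. -/
lemma tendstoInProb_card_pattern {M₁ M₂ α β : ℝ} (hM₁ : 0 ≤ M₁) (hM₂ : 0 ≤ M₂)
    (hβ : β ∈ Set.Icc (0 : ℝ) 1) {ι : Type} [Fintype ι] (g : ι → Pick K₁ K₂ N)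
    (hg : Function.Injective g) (v : ι → Prop) [DecidablePred v] (P : (F : ℕ) → Finset (Fin F))
    (hP : ∀ i F, pickPart α F (g i) = P F) {a : ℝ}
    (ha : Tendsto (fun F : ℕ => (#(P F) : ℝ) / F) atTop (𝓝 a))
    (X : (F : ℕ) → Placement K₁ K₂ N F → Finset (Fin F))
    (hX : ∀ F π b, b ∈ X F π ↔ b ∈ P F ∧ ∀ i, b ∈ placementEquiv K₁ K₂ N F π (g i) ↔ v i) :
    TendstoInProb (placements K₁ K₂ N M₁ M₂ α β) (fun F π => (#(X F π) : ℝ) / F)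
      (a * ∏ i, if v i then frac (pickMem M₁ M₂ β (g i) / a) N
        else 1 - frac (pickMem M₁ M₂ β (g i) / a) N) := by
  classical
  have hXeq : X = fun F π => {b ∈ P F | ∀ i, b ∈ placementEquiv K₁ K₂ N F π (g i) ↔ v i} := by
    funext F π
    ext b
    rw [hX, Finset.mem_filter]
  subst hXeq
  have hmem : ∀ k : Pick K₁ K₂ N, 0 ≤ pickMem M₁ M₂ β k := by
    have := hβ.1
    have := sub_nonneg.2 hβ.2
    rintro (_ | _ | _) <;> simp only [pickMem, Sum.elim_inl, Sum.elim_inr] <;> positivity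
  have ha0 : 0 ≤ a := ge_of_tendsto' ha fun F => by positivity
  let m : (F : ℕ) → Pick K₁ K₂ N → ℕ := fun F k => min ⌊pickMem M₁ M₂ β k * F / N⌋₊ #(P F)
  have hm : ∀ F k, m F k ≤ #(P F) := fun F k => min_le_right _ _
  let ρ : ℕ → ℝ := fun F => ∏ i, pickProb (m F (g i)) #(P F) (v i)
  refine tendstoInProb_of_variance_le (μ := fun F => #(P F) * ρ F) (fun F => ?_) ?_
  · let t : Pick K₁ K₂ N → Finset (Finset (Fin F)) :=
      fun k => picks (pickPart α F k) ⌊pickMem M₁ M₂ β k * F / N⌋₊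
    let J : Finset (Pick K₁ K₂ N) := univ.map ⟨g, hg⟩
    have hJ : ∀ k ∈ J, t k = (P F).powersetCard (m F k) := fun k hk => by
      obtain ⟨i, -, rfl⟩ := Finset.mem_map.1 hk
      simp only [t, m, picks, Function.Embedding.coeFn_mk, hP]
    have hv : ∀ i, (∃ i', g i' = g i ∧ v i') ↔ v i := fun i =>
      ⟨fun ⟨i', h, h'⟩ => hg h ▸ h', fun h => ⟨i, rfl, h⟩⟩
    have h := sum_sq_card_pattern_sub_le t J (P F) (m F) (fun k _ => hm F k) hJ
      fun k => ∃ i, g i = k ∧ v i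
    have hprod : ∏ k ∈ J, pickProb (m F k) #(P F) (∃ i, g i = k ∧ v i) = ρ F := by
      simp only [J, ρ, Finset.prod_map, Function.Embedding.coeFn_mk, hv]
    have hpat : ∀ (ω : Pick K₁ K₂ N → Finset (Fin F)) (b : Fin F),
        (∀ k ∈ J, b ∈ ω k ↔ ∃ i, g i = k ∧ v i) ↔ ∀ i, b ∈ ω (g i) ↔ v i := fun ω b => by
      simp only [J, Finset.mem_map, Finset.mem_univ, true_and, Function.Embedding.coeFn_mk,
        forall_exists_index, forall_apply_eq_imp_iff, hv]
    simp only [hprod, hpat] at h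
    have hcard : #(placements K₁ K₂ N M₁ M₂ α β F) = #(Fintype.piFinset t) :=
      Finset.card_equiv (placementEquiv K₁ K₂ N F) fun π => mem_placements_iff
    rw [hcard, Finset.sum_equiv (placementEquiv K₁ K₂ N F) (t := Fintype.piFinset t)
      (g := fun ω => ((#{b ∈ P F | ∀ i, b ∈ ω (g i) ↔ v i} : ℝ) - #(P F) * ρ F) ^ 2)
      (fun π => mem_placements_iff) fun π _ => rfl]
    refine h.trans ?_
    gcongr
    simpa using Finset.card_le_univ (P F)
  · have hρ0 : ∀ F, 0 ≤ ρ F := fun F => Finset.prod_nonneg fun i _ => pickProb_nonneg (hm F _) _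
    have hρ1 : ∀ F, ρ F ≤ 1 := fun F =>
      Finset.prod_le_one (fun i _ => pickProb_nonneg (hm F _) _)
        fun i _ => pickProb_le_one (hm F _) _
    simp only [mul_div_right_comm]
    rcases ha0.eq_or_lt with h0 | h0
    · -- an asymptotically negligible part, where the cached fraction need not converge
      rw [← h0] at ha ⊢
      rw [zero_mul]
      exact squeeze_zero (fun F => mul_nonneg (by positivity) (hρ0 F))
        (fun F => mul_le_of_le_one_right (by positivity) (hρ1 F)) ha
    · refine ha.mul (tendsto_finsetProd _ fun i _ => ?_)
      have := tendsto_min_floor_div (hmem (g i)) h0 N ha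
      unfold pickProb
      split_ifs
      · exact this
      · exact this.const_sub 1

end RandomPlacement

/-! ### The rates of the schemes -/

section SchemeRates

variable {K₁ K₂ N : ℕ} {M₁ M₂ α β : ℝ}

/-- If all subfiles of a coded block have the same asymptotic length, so has the block. -/
lemma tendstoInProb_codedLen {Ω : ℕ → Type} {s : (F : ℕ) → Finset (Ω F)} {ι : Type}
    {seg : (F : ℕ) → Ω F → Finset ι → ι → Finset (Fin F)} {a p : ℝ} {K : ℕ} (S : Finset ι)
    (h : ∀ k ∈ S, TendstoInProb s (fun F x => (#(seg F x S k) : ℝ) / F) (a * blockRate p K S)) :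
    TendstoInProb s (fun F x => (codedLen (seg F x) S : ℝ) / F) (a * blockRate p K S) := by
  rcases S.eq_empty_or_nonempty with rfl | hS
  · simpa [codedLen, blockRate] using tendstoInProb_const 0
  · exact TendstoInProb.sup hS h

lemma tendstoInProb_codedLen_segA (hM₁ : 0 ≤ M₁) (hM₂ : 0 ≤ M₂) (hα : α ∈ Set.Icc (0 : ℝ) 1)
    (hβ : β ∈ Set.Icc (0 : ℝ) 1) (d : Demand K₁ K₂ N) (j : Fin K₂) (S : Finset (Fin K₁)) :
    TendstoInProb (placements K₁ K₂ N M₁ M₂ α β)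
      (fun F π => (codedLen (segA α π d j) S : ℝ) / F)
      (α * blockRate (frac (M₁ / α) N) K₁ S) := by
  refine tendstoInProb_codedLen S fun i hi => ?_
  have h := tendstoInProb_card_pattern (K₁ := K₁) (K₂ := K₂) (N := N) (α := α) hM₁ hM₂ hβ
    (fun i' : Fin K₁ => .inl (i', d (i, j))) (fun x y h => by simpa using h)
    (fun i' => i' ∈ S.erase i) (firstPart α) (fun _ _ => rfl) (tendsto_card_firstPart_div hα)
    (fun F π => segA α π d j S i) (fun F π b => mem_exclusive)
  simp only [pickMem, Sum.elim_inl] at h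
  rwa [prod_erase_eq_blockRate _ hi, Fintype.card_fin] at h

/-- Being missing at one more node, user `(i, j)`, scales the blocks of scheme A. -/
lemma tendstoInProb_codedLen_segSC (hM₁ : 0 ≤ M₁) (hM₂ : 0 ≤ M₂) (hα : α ∈ Set.Icc (0 : ℝ) 1)
    (hβ : β ∈ Set.Icc (0 : ℝ) 1) (d : Demand K₁ K₂ N) (j : Fin K₂) (S : Finset (Fin K₁)) :
    TendstoInProb (placements K₁ K₂ N M₁ M₂ α β)
      (fun F π => (codedLen (segSC α π d j) S : ℝ) / F)
      (α * (1 - frac (β * M₂ / α) N) * blockRate (frac (M₁ / α) N) K₁ S) := by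
  refine tendstoInProb_codedLen S fun i hi => ?_
  -- The index `none` stands for the pick of user `(i, j)`, which must miss the bit.
  have h := tendstoInProb_card_pattern (K₁ := K₁) (K₂ := K₂) (N := N) (α := α) hM₁ hM₂ hβ
    (fun x : Option (Fin K₁) =>
      x.elim (.inr (.inl ((i, j), d (i, j)))) fun i' => .inl (i', d (i, j)))
    (by rintro (_ | x) (_ | y) h <;> simp at h ⊢; exact h)
    (fun x => ∃ i' ∈ S.erase i, x = some i') (firstPart α)
    (by rintro (_ | x) F <;> rfl) (tendsto_card_firstPart_div hα)
    (fun F π => segSC α π d j S i) (fun F π b => by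
      rw [segSC, Finset.mem_sdiff, segA, mem_exclusive]
      simp [Option.forall, placementEquiv]
      tauto)
  simp only [pickMem, Fintype.prod_option, Option.elim_none, Option.elim_some, Sum.elim_inl,
    Sum.elim_inr, reduceCtorEq, and_false, exists_false, if_false, Option.some_inj,
    exists_eq_right'] at h
  rwa [prod_erase_eq_blockRate _ hi, Fintype.card_fin, ← mul_assoc] at h

lemma tendstoInProb_codedLen_segUser (hM₁ : 0 ≤ M₁) (hM₂ : 0 ≤ M₂) (hα : α ∈ Set.Icc (0 : ℝ) 1)
    (hβ : β ∈ Set.Icc (0 : ℝ) 1) (d : Demand K₁ K₂ N) (i : Fin K₁) (T : Finset (Fin K₂)) :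
    TendstoInProb (placements K₁ K₂ N M₁ M₂ α β)
      (fun F π => (codedLen (segUser α π d i) T : ℝ) / F)
      (α * blockRate (frac (β * M₂ / α) N) K₂ T) := by
  refine tendstoInProb_codedLen T fun j hj => ?_
  have h := tendstoInProb_card_pattern (K₁ := K₁) (K₂ := K₂) (N := N) (α := α) hM₁ hM₂ hβ
    (fun j' : Fin K₂ => .inr (.inl ((i, j'), d (i, j)))) (fun x y h => by simpa using h)
    (fun j' => j' ∈ T.erase j) (firstPart α) (fun _ _ => rfl) (tendsto_card_firstPart_div hα)
    (fun F π => segUser α π d i T j) (fun F π b => mem_exclusive)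
  simp only [pickMem, Sum.elim_inl, Sum.elim_inr] at h
  rwa [prod_erase_eq_blockRate _ hj, Fintype.card_fin] at h

lemma tendstoInProb_codedLen_segB (hM₁ : 0 ≤ M₁) (hM₂ : 0 ≤ M₂) (hα : α ∈ Set.Icc (0 : ℝ) 1)
    (hβ : β ∈ Set.Icc (0 : ℝ) 1) (d : Demand K₁ K₂ N) (S : Finset (User K₁ K₂)) :
    TendstoInProb (placements K₁ K₂ N M₁ M₂ α β)
      (fun F π => (codedLen (segB α π d) S : ℝ) / F)
      ((1 - α) * blockRate (frac ((1 - β) * M₂ / (1 - α)) N) (K₁ * K₂) S) := by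
  refine tendstoInProb_codedLen S fun u hu => ?_
  have h := tendstoInProb_card_pattern (K₁ := K₁) (K₂ := K₂) (N := N) (α := α) hM₁ hM₂ hβ
    (fun u' : User K₁ K₂ => .inr (.inr (u', d u))) (fun x y h => by simpa using h)
    (fun u' => u' ∈ S.erase u) (secondPart α) (fun _ _ => rfl) (tendsto_card_secondPart_div hα)
    (fun F π => segB α π d S u) (fun F π b => mem_exclusive)
  simp only [pickMem, Sum.elim_inr] at h
  rwa [prod_erase_eq_blockRate _ hu, Fintype.card_prod, Fintype.card_fin, Fintype.card_fin] at h

lemma tendstoInProb_serverLen (hM₁ : 0 ≤ M₁) (hM₂ : 0 ≤ M₂) (hα : α ∈ Set.Icc (0 : ℝ) 1)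
    (hβ : β ∈ Set.Icc (0 : ℝ) 1) (d : Demand K₁ K₂ N) (seg : (F : ℕ) → SegmentRule K₁ K₂ N F)
    {c : ℝ} (hseg : ∀ j S, TendstoInProb (placements K₁ K₂ N M₁ M₂ α β)
      (fun F π => (codedLen (seg F π d j) S : ℝ) / F)
      (c * blockRate (frac (M₁ / α) N) K₁ S)) :
    TendstoInProb (placements K₁ K₂ N M₁ M₂ α β)
      (fun F π => (serverLen (seg F) α π d : ℝ) / F)
      (c * (K₂ * mauRate (frac (M₁ / α) N) K₁) +
        (1 - α) * rateB₁ K₁ K₂ N ((1 - β) * M₂ / (1 - α))) := by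
  have h := (TendstoInProb.sum univ fun j _ => TendstoInProb.sum univ fun S _ => hseg j S).add
    (TendstoInProb.sum univ fun S _ => tendstoInProb_codedLen_segB hM₁ hM₂ hα hβ d S)
  simp only [← Finset.mul_sum, ← Finset.sum_div] at h
  have e1 := sum_blockRate (ι := Fin K₁) (frac (M₁ / α) N)
  have e2 := sum_blockRate (ι := User K₁ K₂) (frac ((1 - β) * M₂ / (1 - α)) N)
  rw [Fintype.card_fin] at e1
  rw [Fintype.card_prod, Fintype.card_fin, Fintype.card_fin] at e2
  rw [e1, e2, Finset.sum_const, Finset.card_univ, Fintype.card_fin, nsmul_eq_mul] at h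
  simpa only [serverLen, rateB₁, Nat.cast_add, Nat.cast_sum, add_div] using h

lemma tendstoInProb_helperLen (hM₁ : 0 ≤ M₁) (hM₂ : 0 ≤ M₂) (hα : α ∈ Set.Icc (0 : ℝ) 1)
    (hβ : β ∈ Set.Icc (0 : ℝ) 1) (d : Demand K₁ K₂ N) (i : Fin K₁) :
    TendstoInProb (placements K₁ K₂ N M₁ M₂ α β)
      (fun F π => (helperLen α π d i : ℝ) / F) (rateH₂ K₂ N M₂ α β) := by
  have h := (TendstoInProb.sum univ fun T _ =>
      tendstoInProb_codedLen_segUser hM₁ hM₂ hα hβ d i T).add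
    (TendstoInProb.sum (univ.filter fun S : Finset (User K₁ K₂) => ∃ j, (i, j) ∈ S)
      fun S _ => tendstoInProb_codedLen_segB hM₁ hM₂ hα hβ d S)
  simp only [← Finset.mul_sum, ← Finset.sum_div] at h
  have e1 := sum_blockRate (ι := Fin K₂) (frac (β * M₂ / α) N)
  rw [Fintype.card_fin] at e1
  rw [e1, sum_blockRate_meeting] at h
  simpa only [helperLen, rateH₂, rateSC₂, rateB₂, Nat.cast_add, Nat.cast_sum, add_div] using h

lemma hasRates_of_tendstoInProb (hK₁ : 0 < K₁) (hM₁ : 0 ≤ M₁) (hM₂ : 0 ≤ M₂)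
    (hα : α ∈ Set.Icc (0 : ℝ) 1) (hβ : β ∈ Set.Icc (0 : ℝ) 1)
    {seg : (F : ℕ) → SegmentRule K₁ K₂ N F} {R₁ : ℝ}
    (hserver : ∀ d, TendstoInProb (placements K₁ K₂ N M₁ M₂ α β)
      (fun F π => (serverLen (seg F) α π d : ℝ) / F) R₁) :
    HasRates K₁ K₂ N M₁ M₂ α β seg R₁ (rateH₂ K₂ N M₂ α β) := by
  intro ε hε
  have : Nonempty (Fin K₁) := ⟨⟨0, hK₁⟩⟩
  exact (WithHighProb.forall fun d => (hserver d ε hε).and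
    (TendstoInProb.sup univ_nonempty (fun i _ => tendstoInProb_helperLen hM₁ hM₂ hα hβ d i)
      ε hε)).tendsto_one fun F => placements_nonempty M₁ M₂ α β

lemma hasRates_segSC (hK₁ : 0 < K₁) (hM₁ : 0 ≤ M₁) (hM₂ : 0 ≤ M₂) (hα : α ∈ Set.Icc (0 : ℝ) 1)
    (hβ : β ∈ Set.Icc (0 : ℝ) 1) :
    HasRates K₁ K₂ N M₁ M₂ α β (fun _ => segSC α)
      (rateH₁ K₁ K₂ N M₁ M₂ α β) (rateH₂ K₂ N M₂ α β) := by
  refine hasRates_of_tendstoInProb hK₁ hM₁ hM₂ hα hβ fun d => ?_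
  have h := tendstoInProb_serverLen hM₁ hM₂ hα hβ d (fun _ => segSC α)
    (tendstoInProb_codedLen_segSC hM₁ hM₂ hα hβ d)
  convert h using 1
  rw [rateH₁, rateSC₁]
  ring

lemma hasRates_segA (hK₁ : 0 < K₁) (hM₁ : 0 ≤ M₁) (hM₂ : 0 ≤ M₂) (hα : α ∈ Set.Icc (0 : ℝ) 1)
    (hβ : β ∈ Set.Icc (0 : ℝ) 1) :
    HasRates K₁ K₂ N M₁ M₂ α β (fun _ => segA α)
      (rateG₁ K₁ K₂ N M₁ M₂ α β) (rateG₂ K₂ N M₂ α β) := by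
  refine hasRates_of_tendstoInProb hK₁ hM₁ hM₂ hα hβ fun d => ?_
  have h := tendstoInProb_serverLen hM₁ hM₂ hα hβ d (fun _ => segA α)
    (tendstoInProb_codedLen_segA hM₁ hM₂ hα hβ d)
  convert h using 1
  rw [rateG₁, rateA₁]

end SchemeRates

end TwoLayer

end

open TwoLayer in
theorem lemma3 (K₁ K₂ N : ℕ) (hK₁ : 2 ≤ K₁) (hK₂ : 2 ≤ K₂) (hN : 1 ≤ N)
    (M₁ M₂ : ℝ) (hM₁ : 0 ≤ M₁) (hM₁N : M₁ ≤ N) (hM₂ : 0 ≤ M₂) (hM₂N : M₂ ≤ N)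
    (α β : ℝ) (hα : α ∈ Set.Icc (0 : ℝ) 1) (hβ : β ∈ Set.Icc (0 : ℝ) 1) :
    -- every placement fits into the memories, and then delivery is error-free for every demand;
    -- the hybrid server message is never longer than that of the generalized scheme
    (∀ F : ℕ, (placements K₁ K₂ N M₁ M₂ α β F).Nonempty ∧
      ∀ π ∈ placements K₁ K₂ N M₁ M₂ α β F, FitsMemory M₁ M₂ π ∧
        ∀ d : Demand K₁ K₂ N,
          DeliveryWorks (segSC α) α π d ∧ DeliveryWorks (segA α) α π d ∧
          serverLen (segSC α) α π d ≤ serverLen (segA α) α π d) ∧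
    -- the rates of the hybrid scheme and of the generalized scheme
    HasRates K₁ K₂ N M₁ M₂ α β (fun _ => segSC α)
      (rateH₁ K₁ K₂ N M₁ M₂ α β) (rateH₂ K₂ N M₂ α β) ∧
    HasRates K₁ K₂ N M₁ M₂ α β (fun _ => segA α)
      (rateG₁ K₁ K₂ N M₁ M₂ α β) (rateG₂ K₂ N M₂ α β) ∧
    -- the rates of the hybrid scheme are achievable
    (rateH₁ K₁ K₂ N M₁ M₂ α β, rateH₂ K₂ N M₂ α β) ∈ feasibleRegion K₁ K₂ N M₁ M₂ ∧
    -- the explicit form of the rates when no denominator vanishes and no memory exceeds its part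
    (0 < α → α < 1 → 0 < β → β < 1 → 0 < M₁ → 0 < M₂ →
      M₁ ≤ α * N → β * M₂ ≤ α * N → (1 - β) * M₂ ≤ (1 - α) * N →
      rateH₁ K₁ K₂ N M₁ M₂ α β =
        α * K₂ * (1 - M₁ / (α * N)) * (1 - β * M₂ / (α * N)) * (α * N / M₁) *
            (1 - (1 - M₁ / (α * N)) ^ K₁) +
          (1 - α) * (1 - (1 - β) * M₂ / ((1 - α) * N)) * ((1 - α) * N / ((1 - β) * M₂)) *
            (1 - (1 - (1 - β) * M₂ / ((1 - α) * N)) ^ (K₁ * K₂)) ∧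
      rateH₂ K₂ N M₂ α β =
        α * (1 - β * M₂ / (α * N)) * (α * N / (β * M₂)) *
            (1 - (1 - β * M₂ / (α * N)) ^ K₂) +
          (1 - α) * (1 - (1 - β) * M₂ / ((1 - α) * N)) * ((1 - α) * N / ((1 - β) * M₂)) *
            (1 - (1 - (1 - β) * M₂ / ((1 - α) * N)) ^ K₂)) ∧
    -- comparison with the generalized scheme
    rateH₁ K₁ K₂ N M₁ M₂ α β ≤ rateG₁ K₁ K₂ N M₁ M₂ α β ∧
    rateH₂ K₂ N M₂ α β = rateG₂ K₂ N M₂ α β := by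
  have hK₁0 : 0 < K₁ := by omega
  refine ⟨fun F => ⟨placements_nonempty M₁ M₂ α β, fun π hπ =>
      ⟨fitsMemory_of_mem_placements hN hM₁ hM₂ hβ hπ, fun d => ⟨deliveryWorks_segSC α π d,
        deliveryWorks_segA α π d, serverLen_segSC_le α π d⟩⟩⟩,
    hasRates_segSC hK₁0 hM₁ hM₂ hα hβ, hasRates_segA hK₁0 hM₁ hM₂ hα hβ,
    mem_feasibleRegion_of_hasRates hN hM₁ hM₂ hβ (fun _ π d => deliveryWorks_segSC α π d)
      (hasRates_segSC hK₁0 hM₁ hM₂ hα hβ),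
    fun hα0 hα1 hβ0 hβ1 hM₁0 hM₂0 h1 h2 h3 => ?_, rateH₁_le_rateG₁ K₁ K₂ N hM₁ hM₂ hα.1 hβ.1, rfl⟩
  have e1 := mul_mauRate_frac hN hα0 hM₁0 h1
  have e2 := mul_mauRate_frac hN hα0 (mul_pos hβ0 hM₂0) h2
  have e3 := mul_mauRate_frac hN (sub_pos.2 hα1) (mul_pos (sub_pos.2 hβ1) hM₂0) h3
  constructor
  · rw [rateH₁, rateSC₁, rateB₁, (e1 K₁).2, (e2 K₁).1, (e3 (K₁ * K₂)).2]
    ring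
  · rw [rateH₂, rateSC₂, rateB₂, (e2 K₂).2, (e3 K₂).2]
    ring
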